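/- Let $d\in\{2,3\}$ and let $\Omega\subset\mathbb{R}^d$ be a bounded connected open set with smooth boundary (not necessarily simply connected). Let $\gamma_1,\gamma_2,W\in C^\infty(\partial\Omega)$ with $\gamma_1,\gamma_2>0$. Let $(c_1^*,c_2^*,\Phi^*,u^*)$ be a (classical) solution of the steady Nernst-Planck-Navier-Stokes system: $c_1^*,c_2^*,\Phi^*\in C^2(\Omega)\cap C^1(\overline\Omega)$ and $u^*\in C^2(\Omega;\mathbb{R}^d)\cap C(\overline\Omega;\mathbb{R}^d)$ (in particular this holds for solutions that are smooth on $\overline\Omega$) satisfy, for some pressure $p^*\in C^1(\Omega)$, $$u^*\cdot\nabla c_1^*=\operatorname{div}(\nabla c_1^*+c_1^*\nabla\Phi^*),\qquad u^*\cdot\nabla c_2^*=\operatorname{div}(\nabla c_2^*-c_2^*\nabla\Phi^*),$$ $$-\Delta\Phi^*=c_1^*-c_2^*,\qquad u^*\cdot\nabla u^*-\Delta u^*+\nabla p^*=-(c_1^*-c_2^*)\nabla\Phi^*,\qquad \operatorname{div}u^*=0$$ in $\Omega$, and $c_1^*=\gamma_1$, $c_2^*=\gamma_2$, $\Phi^*=W$,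 $u^*=0$ on $\partial\Omega$. Let $n$ be the outward unit normal along $\partial\Omega$ and $dS$ the surface measure; for $i\ne j$ the operator $n_i\partial_j-n_j\partial_i$ is the derivative along the tangential vector field $n_ie_j-n_je_i$ and so acts on functions on $\partial\Omega$. If for some $i,j\in\{1,\dots,d\}$ with $i\neq j$ $$\int_{\partial\Omega}(\gamma_1-\gamma_2)\,(n_i\partial_j-n_j\partial_i)W\,dS\neq0\qquad\text{or}\qquad\int_{\partial\Omega}W\,(n_i\partial_j-n_j\partial_i)(\gamma_1-\gamma_2)\,dS\neq0,$$ then $u^*\not\equiv0$ in $\Omega$. -/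

import Mathlib

open MeasureTheory
open scoped ContDiff

noncomputable section

/-- Euclidean space `ℝᵈ`. -/
abbrev Euc (d : ℕ) : Type := EuclideanSpace ℝ (Fin d)

/-- The `i`-th vector of the canonical basis of `ℝᵈ`. -/
def stdVec {d : ℕ} (i : Fin d) : Euc d := EuclideanSpace.single i 1

/-- `g` is a smooth local defining function of `Ω` at the boundary point `x`: near `x`, the set `Ω`
is `{g < 0}` and the gradient of `g` does not vanish. -/
def IsLocalDefiningFunction {d : ℕ} (Ω : Set (Euc d)) (x : Euc d) (g : Euc d → ℝ) : Prop :=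
  ∃ U : Set (Euc d), IsOpen U ∧ x ∈ U ∧ ContDiffOn ℝ ∞ g U ∧
    (∀ y ∈ U, gradient g y ≠ 0) ∧ Ω ∩ U = {y ∈ U | g y < 0}

/-- Bounded, connected, nonempty open sets with smooth boundary (not necessarily simply connected,
and with a possibly disconnected boundary). -/
structure IsSmoothBoundedDomain {d : ℕ} (Ω : Set (Euc d)) : Prop where
  isOpen : IsOpen Ω
  isConnected : IsConnected Ω
  isBounded : Bornology.IsBounded Ω
  smooth_boundary : ∀ x ∈ frontier Ω, ∃ g : Euc d → ℝ, IsLocalDefiningFunction Ω x g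

open Classical in
/-- The outward unit normal at a boundary point: `∇g / |∇g|` for a local defining function `g`.
The value does not depend on which `g` is chosen, because the gradients at `x` of any two local
defining functions are positive multiples of each other. It is `0` if there is no such `g`. -/
def outerNormal {d : ℕ} (Ω : Set (Euc d)) (x : Euc d) : Euc d :=
  if h : ∃ g : Euc d → ℝ, IsLocalDefiningFunction Ω x g then
    ‖gradient h.choose x‖⁻¹ • gradient h.choose x
  else 0

/-- The surface measure `dS` on `∂Ω`: the `(d-1)`-dimensional Hausdorff measure, normalised to
agree with Lebesgue measure on `ℝᵈ⁻¹`, restricted to `∂Ω`. -/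
def surfaceMeasure {d : ℕ} (Ω : Set (Euc d)) : Measure (Euc d) :=
  (μHE[d - 1] : Measure (Euc d)).restrict (frontier Ω)

/-- The tangential derivative `(nᵢ ∂ⱼ - nⱼ ∂ᵢ) f` at `x ∈ ∂Ω` of a function `f` on `∂Ω`. Only the
values of `f` on `∂Ω` enter. The derivative within `∂Ω` is determined on vectors tangent to `∂Ω`,
and `nᵢ eⱼ - nⱼ eᵢ` is such a vector. -/
def tangentialDeriv {d : ℕ} (Ω : Set (Euc d)) (i j : Fin d) (f : Euc d → ℝ) (x : Euc d) : ℝ :=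
  fderivWithin ℝ f (frontier Ω) x
    (outerNormal Ω x i • stdVec j - outerNormal Ω x j • stdVec i)

/-- The divergence `∑ᵢ ∂ᵢ Fᵢ` of a vector field. -/
def divergence {d : ℕ} (F : Euc d → Euc d) (x : Euc d) : ℝ :=
  ∑ i : Fin d, fderiv ℝ (fun y => F y i) x (stdVec i)

/-- `f ∈ C²(Ω) ∩ C¹(closure of Ω)`. -/
def IsC2UpToC1 {d : ℕ} (Ω : Set (Euc d)) (f : Euc d → ℝ) : Prop :=
  ContDiffOn ℝ 2 f Ω ∧ ContDiffOn ℝ 1 f (closure Ω)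

/-- `(c₁, c₂, Φ, u)` is a classical solution of the steady Nernst-Planck-Navier-Stokes system in `Ω`
(for some pressure `p`) with boundary values `γ₁, γ₂` for the concentrations, `W` for the
potential and `0` for the velocity. -/
structure IsSteadyNPNS {d : ℕ} (Ω : Set (Euc d)) (γ₁ γ₂ W : Euc d → ℝ)
    (c₁ c₂ Φ : Euc d → ℝ) (u : Euc d → Euc d) : Prop where
  reg_c₁ : IsC2UpToC1 Ω c₁
  reg_c₂ : IsC2UpToC1 Ω c₂
  reg_Φ : IsC2UpToC1 Ω Φ
  reg_u : ContDiffOn ℝ 2 u Ω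
  cont_u : ContinuousOn u (closure Ω)
  nernstPlanck₁ : ∀ x ∈ Ω, inner ℝ (u x) (gradient c₁ x) =
    divergence (fun y => gradient c₁ y + c₁ y • gradient Φ y) x
  nernstPlanck₂ : ∀ x ∈ Ω, inner ℝ (u x) (gradient c₂ x) =
    divergence (fun y => gradient c₂ y - c₂ y • gradient Φ y) x
  poisson : ∀ x ∈ Ω, -(Laplacian.laplacian Φ x) = c₁ x - c₂ x
  navierStokes : ∃ p : Euc d → ℝ, ContDiffOn ℝ 1 p Ω ∧ ∀ x ∈ Ω,
    fderiv ℝ u x (u x) - Laplacian.laplacian u x + gradient p x =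
      -((c₁ x - c₂ x) • gradient Φ x)
  incompressible : ∀ x ∈ Ω, divergence u x = 0
  boundary_c₁ : ∀ x ∈ frontier Ω, c₁ x = γ₁ x
  boundary_c₂ : ∀ x ∈ frontier Ω, c₂ x = γ₂ x
  boundary_Φ : ∀ x ∈ frontier Ω, Φ x = W x
  boundary_u : ∀ x ∈ frontier Ω, u x = 0

end

open Filter Topology Set Metric Module
open scoped NNReal ENNReal Manifold

/-! Suppose the fluid is at rest and put `ρ = c₁ - c₂`. The momentum equation becomes `∇p = -ρ ∇Φ`,
so `ρ ∇Φ` has the single-valued potential `-p` in `Ω`, whatever the topology of `Ω`. By the product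
rule `Φ ∇ρ = ∇(ρΦ + p)` is exact too. For an exact field `∇q`, the field `∂ⱼq eᵢ - ∂ᵢq eⱼ` is
divergence free, and its flux through `∂Ω` is the integral of `(nᵢ∂ⱼ - nⱼ∂ᵢ)q`; hence that integral
vanishes. On `∂Ω` one has `ρ = γ₁ - γ₂` and `Φ = W`, and tangential derivatives see only boundary
values, so both integrals of the hypothesis would be zero.

The analytic difficulty is that `q` is only `C¹` in `Ω`, with a gradient continuous up to `∂Ω`. The
divergence theorem is therefore proved for continuous fields that are divergence free in the weak
sense (`IsSmoothBoundedDomain.integral_flux_eq_zero`). A partition of unity reduces it to graph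
charts (`IsLocalGraph.integral_flux`), where a test function is cut off at distance `1/c` below the
graph and `c → ∞`: the derivative of the cutoff concentrates on the graph and produces the flux.
Since `dS` is a Hausdorff measure, an area formula (`map_restrict_euclideanHausdorffMeasure_image`)
turns surface integrals into integrals over the base of the chart. The weak condition for rotated
gradients is `integral_fderiv_mul_fderiv_sub_eq_zero`, and
`IsSmoothBoundedDomain.tangentialDeriv_eq` relates tangential derivatives of the data to gradients
of the solution. -/

/-! ### Hausdorff measure and the area formula -/

/-- Euclidean Hausdorff measures of two parametrised sets are comparable when the distances are. -/
theorem euclideanHausdorffMeasure_image_le_of_dist_le {X Y Z : Type*}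
    [MetricSpace Y] [MeasurableSpace Y] [BorelSpace Y]
    [MetricSpace Z] [MeasurableSpace Z] [BorelSpace Z]
    {f : X → Y} {g : X → Z} {s : Set X} {K : ℝ≥0} (m : ℕ)
    (h : ∀ x ∈ s, ∀ y ∈ s, dist (f x) (f y) ≤ K * dist (g x) (g y)) :
    μHE[m] (f '' s) ≤ (K : ℝ≥0∞) ^ m * μHE[m] (g '' s) := by
  rcases s.eq_empty_or_nonempty with rfl | ⟨x₀, hx₀⟩
  · simp
  have : Nonempty X := ⟨x₀⟩
  have hlip : LipschitzOnWith K (f ∘ Function.invFunOn g s) (g '' s) := by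
    refine LipschitzOnWith.of_dist_le_mul fun a ha b hb => ?_
    have h1 := h _ (Function.invFunOn_mem ha) _ (Function.invFunOn_mem hb)
    rwa [Function.invFunOn_eq ha, Function.invFunOn_eq hb] at h1
  have himg : f '' s = (f ∘ Function.invFunOn g s) '' (g '' s) := by
    -- `g` need not be injective, but points of `s` with equal `g` have equal `f`, so any choice of
    -- preimage gives the same value.
    have key : ∀ x ∈ s, f (Function.invFunOn g s (g x)) = f x := by
      intro x hx
      have hx' : g x ∈ g '' s := mem_image_of_mem g hx
      have h1 := h _ (Function.invFunOn_mem hx') x hx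
      rw [Function.invFunOn_eq hx', dist_self, mul_zero] at h1
      exact dist_le_zero.1 h1
    ext y
    constructor
    · rintro ⟨x, hx, rfl⟩
      exact ⟨g x, mem_image_of_mem g hx, key x hx⟩
    · rintro ⟨_, ⟨x, hx, rfl⟩, rfl⟩
      exact ⟨x, hx, (key x hx).symm⟩
  have h2 := hlip.hausdorffMeasure_image_le (d := (m : ℝ)) (Nat.cast_nonneg m)
  rw [← himg, ENNReal.rpow_natCast] at h2
  simp only [Measure.euclideanHausdorffMeasure_def, Measure.smul_apply,
    Measure.nnreal_smul_coe_apply]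
  calc _ ≤ _ := mul_le_mul_right h2 _
    _ = _ := mul_left_comm _ _ _

section AreaFormula

variable {U V : Type*} [NormedAddCommGroup U] [InnerProductSpace ℝ U] [FiniteDimensional ℝ U]
  [MeasurableSpace U] [BorelSpace U] [NormedAddCommGroup V] [InnerProductSpace ℝ V]
  [MeasurableSpace V] [BorelSpace V]

/-- Near a point where the derivative is expanding, a parametrisation distorts Hausdorff measure
like its derivative, up to a factor close to `1`. -/
theorem eventually_euclideanHausdorffMeasure_image_closedBall {Ψ : U → V} {L : U →L[ℝ] V} {x : U}
    (hΨ : HasStrictFDerivAt Ψ L x) (hL : ∀ w, ‖w‖ ≤ ‖L w‖) {K : ℝ≥0} (hK : 1 < K) :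
    ∀ᶠ r in 𝓝[>] (0 : ℝ),
      μHE[finrank ℝ U] (Ψ '' closedBall x r) ≤ (K : ℝ≥0∞) ^ finrank ℝ U *
        (ENNReal.ofReal (L : U →ₗ[ℝ] V).normDet * volume (closedBall x r)) ∧
      ENNReal.ofReal (L : U →ₗ[ℝ] V).normDet * volume (closedBall x r) ≤
        (K : ℝ≥0∞) ^ finrank ℝ U * μHE[finrank ℝ U] (Ψ '' closedBall x r) := by
  have hK' : (1 : ℝ) < K := by exact_mod_cast hK
  -- This `δ` serves both inequalities: `1 - δ = K⁻¹`, and `1 + δ ≤ K` because `K + K⁻¹ ≥ 2`.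
  set δ : ℝ := 1 - (K : ℝ)⁻¹ with hδ
  have hδ0 : 0 < δ := by
    have := inv_lt_one_of_one_lt₀ hK'
    linarith
  have hKδ : 1 + δ ≤ K := by
    have h1 : 0 < (K : ℝ) := by linarith
    have h2 : (K : ℝ) * (K : ℝ)⁻¹ = 1 := mul_inv_cancel₀ h1.ne'
    have h3 : 0 < (K : ℝ)⁻¹ := inv_pos.2 h1
    nlinarith [sq_nonneg ((K : ℝ) - 1)]
  have happrox := hΨ.isLittleO.bound hδ0
  obtain ⟨ε, hε, hball⟩ := Metric.eventually_nhds_iff_ball.1 happrox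
  have hr : ∀ᶠ r in 𝓝[>] (0 : ℝ), r < ε :=
    mem_nhdsWithin_of_mem_nhds (Iio_mem_nhds hε)
  filter_upwards [hr] with r hr
  -- Strict differentiability lets both points vary, and the expansion `hL` makes the error relative
  -- to `‖L (y - z)‖` instead of `‖y - z‖`.
  have hd : ∀ y ∈ closedBall x r, ∀ z ∈ closedBall x r,
      ‖Ψ y - Ψ z - L (y - z)‖ ≤ δ * ‖L (y - z)‖ := by
    intro y hy z hz
    have h1 := hball (y, z) (by
      rw [← ball_prod_same]
      exact ⟨closedBall_subset_ball hr hy, closedBall_subset_ball hr hz⟩)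
    exact h1.trans (mul_le_mul_of_nonneg_left (hL _) hδ0.le)
  have hA : μHE[finrank ℝ U] (L '' closedBall x r) =
      ENNReal.ofReal (L : U →ₗ[ℝ] V).normDet * volume (closedBall x r) :=
    (L : U →ₗ[ℝ] V).euclideanHausdorffMeasure_image_eq_normDet_mul_volume _
  rw [← hA]
  constructor
  · refine euclideanHausdorffMeasure_image_le_of_dist_le _ fun y hy z hz => ?_
    rw [dist_eq_norm, dist_eq_norm, ← map_sub]
    have h1 := hd y hy z hz
    have h2 := norm_le_norm_add_norm_sub' (Ψ y - Ψ z) (L (y - z))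
    nlinarith [norm_nonneg (L (y - z))]
  · refine euclideanHausdorffMeasure_image_le_of_dist_le _ fun y hy z hz => ?_
    rw [dist_eq_norm, dist_eq_norm, ← map_sub]
    have h1 := hd y hy z hz
    have h2 := norm_le_norm_add_norm_sub (Ψ y - Ψ z) (L (y - z))
    have h3 : (K : ℝ)⁻¹ * ‖L (y - z)‖ ≤ ‖Ψ y - Ψ z‖ := by
      have : (K : ℝ)⁻¹ = 1 - δ := by rw [hδ]; ring
      rw [this]; nlinarith
    rwa [inv_mul_le_iff₀ (by linarith)] at h3

/-- The area formula for a parametrisation with a measurable left inverse and an expanding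
derivative. -/
theorem map_restrict_euclideanHausdorffMeasure_image {Ψ : U → V} {Ψ' : U → U →L[ℝ] V} {P : V → U}
    {B : Set U} (hB : IsOpen B) (hΨ : ∀ x ∈ B, HasStrictFDerivAt Ψ (Ψ' x) x)
    (hL : ∀ x ∈ B, ∀ w, ‖w‖ ≤ ‖Ψ' x w‖) {C : ℝ≥0} (hlip : LipschitzOnWith C Ψ B)
    (hP : Measurable P) (hPΨ : ∀ x ∈ B, P (Ψ x) = x) :
    ((μHE[finrank ℝ U] : Measure V).restrict (Ψ '' B)).map P =
      (volume.restrict B).withDensity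
        (fun x => ENNReal.ofReal (Ψ' x : U →ₗ[ℝ] V).normDet) := by
  set ν := ((μHE[finrank ℝ U] : Measure V).restrict (Ψ '' B)).map P with hν
  have hνA : ∀ A, MeasurableSet A → ν A = μHE[finrank ℝ U] (Ψ '' (A ∩ B)) := by
    intro A hA
    rw [hν, Measure.map_apply hP hA, Measure.restrict_apply (hP hA)]
    congr 1
    ext z
    constructor
    · rintro ⟨h1, x, hx, rfl⟩
      exact ⟨x, ⟨by simpa [hPΨ x hx] using h1, hx⟩, rfl⟩
    · rintro ⟨x, ⟨hxA, hx⟩, rfl⟩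
      exact ⟨by simpa [hPΨ x hx] using hxA, x, hx, rfl⟩
  -- This bound makes `ν` locally finite and absolutely continuous, so `ν` is recovered from its
  -- Radon-Nikodym density, which Besicovitch differentiation computes as a limit of ratios over
  -- balls.
  have hνle : ν ≤ ((C : ℝ≥0∞) ^ finrank ℝ U) • (volume : Measure U) := by
    refine Measure.le_iff.2 fun A hA => ?_
    rw [hνA A hA, Measure.smul_apply, smul_eq_mul,
      ← InnerProductSpace.euclideanHausdorffMeasure_eq_volume]
    refine (euclideanHausdorffMeasure_image_le_of_dist_le (g := id) _
      (fun x hx y hy => hlip.dist_le_mul x hx.2 y hy.2)).trans ?_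
    rw [image_id]
    exact mul_le_mul_right (measure_mono inter_subset_left) _
  have hCtop : (C : ℝ≥0∞) ^ finrank ℝ U ≠ ⊤ := ENNReal.pow_ne_top ENNReal.coe_ne_top
  have : IsLocallyFiniteMeasure ν := by
    refine ⟨fun x => ⟨ball x 1, ball_mem_nhds x one_pos, ?_⟩⟩
    refine (hνle _).trans_lt ?_
    rw [Measure.smul_apply, smul_eq_mul]
    exact ENNReal.mul_lt_top hCtop.lt_top measure_ball_lt_top
  have hac : ν ≪ volume := by
    refine Measure.AbsolutelyContinuous.mk fun A _ h0 => ?_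
    refine nonpos_iff_eq_zero.1 ((hνle A).trans ?_)
    simp [h0]
  have hdens : ∀ᵐ x ∂(volume : Measure U), x ∈ B →
      ν.rnDeriv volume x = ENNReal.ofReal (Ψ' x : U →ₗ[ℝ] V).normDet := by
    filter_upwards [Besicovitch.ae_tendsto_rnDeriv ν (volume : Measure U)] with x hx hxB
    set J := ENNReal.ofReal (Ψ' x : U →ₗ[ℝ] V).normDet
    have hbounds : ∀ K : ℝ≥0, 1 < K →
        ν.rnDeriv volume x ≤ (K : ℝ≥0∞) ^ finrank ℝ U * J ∧
        J ≤ (K : ℝ≥0∞) ^ finrank ℝ U * ν.rnDeriv volume x := by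
      intro K hK
      have hKtop : (K : ℝ≥0∞) ^ finrank ℝ U ≠ ⊤ := ENNReal.pow_ne_top ENNReal.coe_ne_top
      have hev := eventually_euclideanHausdorffMeasure_image_closedBall (hΨ x hxB) (hL x hxB) hK
      have hsub : ∀ᶠ r in 𝓝[>] (0 : ℝ), closedBall x r ⊆ B := by
        obtain ⟨ε, hε, hb⟩ := Metric.isOpen_iff.1 hB x hxB
        have hr : ∀ᶠ r in 𝓝[>] (0 : ℝ), r < ε := mem_nhdsWithin_of_mem_nhds (Iio_mem_nhds hε)
        filter_upwards [hr] with r hr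
        exact (closedBall_subset_ball hr).trans hb
      have hboth : ∀ᶠ r in 𝓝[>] (0 : ℝ),
          ν (closedBall x r) / volume (closedBall x r) ≤ (K : ℝ≥0∞) ^ finrank ℝ U * J ∧
          J ≤ (K : ℝ≥0∞) ^ finrank ℝ U * (ν (closedBall x r) / volume (closedBall x r)) := by
        filter_upwards [hev, hsub, self_mem_nhdsWithin] with r h1 h2 hr
        have hpos : volume (closedBall x r) ≠ 0 := (measure_closedBall_pos _ _ hr).ne'
        have hfin : volume (closedBall x r) ≠ ⊤ := measure_closedBall_lt_top.ne
        rw [← inter_eq_left.2 h2, ← hνA _ measurableSet_closedBall, inter_eq_left.2 h2] at h1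
        refine ⟨ENNReal.div_le_of_le_mul (by rw [mul_assoc]; exact h1.1), ?_⟩
        rw [← mul_div_assoc, ENNReal.le_div_iff_mul_le (Or.inl hpos) (Or.inl hfin)]
        exact h1.2
      refine ⟨le_of_tendsto hx (hboth.mono fun r h => h.1), ?_⟩
      exact ge_of_tendsto (ENNReal.Tendsto.const_mul hx (Or.inr hKtop))
        (hboth.mono fun r h => h.2)
    -- Letting `K` decrease to `1` in `hbounds` squeezes the density to the Jacobian.
    have hlim : ∀ a : ℝ≥0∞, Tendsto (fun K : ℝ≥0 => (K : ℝ≥0∞) ^ finrank ℝ U * a)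
        (𝓝[>] 1) (𝓝 a) := by
      intro a
      have h1 : Tendsto (fun K : ℝ≥0 => (K : ℝ≥0∞) ^ finrank ℝ U) (𝓝[>] 1) (𝓝 1) := by
        have : Continuous fun K : ℝ≥0 => (K : ℝ≥0∞) ^ finrank ℝ U :=
          (ENNReal.continuous_pow _).comp ENNReal.continuous_coe
        simpa using (this.tendsto 1).mono_left nhdsWithin_le_nhds
      simpa using ENNReal.Tendsto.mul_const h1 (Or.inl one_ne_zero)
    refine le_antisymm (ge_of_tendsto (hlim _) ?_) (ge_of_tendsto (hlim _) ?_)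
    · filter_upwards [self_mem_nhdsWithin] with K hK using (hbounds K hK).1
    · filter_upwards [self_mem_nhdsWithin] with K hK using (hbounds K hK).2
  have hrestrict : ν.restrict B = ν := by
    refine Measure.restrict_eq_self_of_ae_mem ?_
    rw [ae_iff]
    have := hνA Bᶜ hB.measurableSet.compl
    rw [compl_inter_self, image_empty, measure_empty] at this
    exact this
  rw [← hrestrict]
  conv_lhs => rw [← Measure.withDensity_rnDeriv_eq _ _ hac]
  rw [restrict_withDensity hB.measurableSet]
  exact withDensity_congr_ae ((ae_restrict_iff' hB.measurableSet).2 hdens)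

end AreaFormula

/-! ### The outward normal does not depend on the defining function -/

section OuterNormal

variable {d : ℕ} {Ω : Set (Euc d)} {x : Euc d}

/-- Along a direction in which a function vanishing at `x` decreases, it becomes negative. -/
theorem eventually_add_smul_neg {E : Type*} [NormedAddCommGroup E] [InnerProductSpace ℝ E]
    [CompleteSpace E] {g : E → ℝ} {x w v : E} (hg : HasGradientAt g w x) (hx : g x = 0)
    (hv : inner ℝ w v < 0) : ∀ᶠ t in 𝓝[>] (0 : ℝ), g (x + t • v) < 0 := by
  have h1 : HasDerivAt (fun t : ℝ => g (x + t • v)) (inner ℝ w v) 0 := by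
    have hline : HasDerivAt (fun t : ℝ => x + t • v) v 0 := by
      simpa using ((hasDerivAt_id (0 : ℝ)).smul_const v).const_add x
    have hg' : HasFDerivAt g (InnerProductSpace.toDual ℝ E w) (x + (0 : ℝ) • v) := by
      simpa using hg.hasFDerivAt
    have h := hg'.comp_hasDerivAt (0 : ℝ) hline
    rwa [InnerProductSpace.toDual_apply_apply] at h
  have h2 := hasDerivAt_iff_tendsto_slope.1 h1
  have h3 : ∀ᶠ t in 𝓝[>] (0 : ℝ), slope (fun t : ℝ => g (x + t • v)) 0 t < 0 :=
    (h2.mono_left (nhdsWithin_mono _ fun t (ht : 0 < t) => ht.ne')).eventually (gt_mem_nhds hv)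
  filter_upwards [h3, self_mem_nhdsWithin] with t ht ht0
  have ht0' : (0 : ℝ) < t := ht0
  rw [slope_def_field] at ht
  simp only [zero_smul, add_zero, hx, sub_zero] at ht
  by_contra hcon
  exact absurd ht (not_lt.2 (div_nonneg (not_lt.1 hcon) ht0'.le))

theorem eq_zero_of_mem_frontier {E : Type*} [TopologicalSpace E] {Ω : Set E} {x : E} {g : E → ℝ}
    (hΩ : IsOpen Ω) (hx : x ∈ frontier Ω) (hg : ContinuousAt g x)
    (hdef : ∀ᶠ y in 𝓝 x, y ∈ Ω ↔ g y < 0) : g x = 0 := by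
  rw [hΩ.frontier_eq] at hx
  refine le_antisymm ?_ (not_lt.1 fun h => hx.2 (hdef.self_of_nhds.2 h))
  by_contra hpos
  have h1 : ∀ᶠ y in 𝓝 x, y ∉ Ω := by
    filter_upwards [hg.eventually (lt_mem_nhds (not_le.1 hpos)), hdef] with y hy hy'
    exact fun h => absurd (hy'.1 h) (not_lt.2 hy.le)
  exact (mem_closure_iff_frequently.1 hx.1) h1

/-- The outer normal can be computed from any differentiable function which defines `Ω` near `x`
and has nonzero gradient there. -/
theorem outerNormal_eq (hΩ : IsOpen Ω) (hx : x ∈ frontier Ω)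
    (hex : ∃ g : Euc d → ℝ, IsLocalDefiningFunction Ω x g) {h : Euc d → ℝ} {w : Euc d}
    (hw : w ≠ 0) (hh : HasGradientAt h w x) (hdef : ∀ᶠ y in 𝓝 x, y ∈ Ω ↔ h y < 0) :
    outerNormal Ω x = ‖w‖⁻¹ • w := by
  rw [outerNormal, dif_pos hex]
  obtain ⟨U, hU, hxU, -, hgrad, hΩU⟩ := hex.choose_spec
  set g := hex.choose
  set a := gradient g x with ha
  have ha0 : a ≠ 0 := hgrad x hxU
  have hga : HasGradientAt g a x := by
    refine DifferentiableAt.hasGradientAt ?_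
    by_contra hcon
    exact ha0 (gradient_eq_zero_of_not_differentiableAt hcon)
  have hgdef : ∀ᶠ y in 𝓝 x, y ∈ Ω ↔ g y < 0 := by
    filter_upwards [hU.mem_nhds hxU] with y hy
    have := Set.ext_iff.1 hΩU y
    simp only [mem_inter_iff, hy, and_true, mem_ofPred_eq, true_and] at this
    exact this
  have hg0 := eq_zero_of_mem_frontier hΩ hx hga.continuousAt hgdef
  have hh0 := eq_zero_of_mem_frontier hΩ hx hh.continuousAt hdef
  -- If the unit gradients `p` and `q` differ, moving from `x` along `q - p` decreases `g` and
  -- increases `h`, so nearby points would be both inside and outside `Ω`.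
  by_contra hne
  set p := ‖a‖⁻¹ • a with hp
  set q := ‖w‖⁻¹ • w with hq
  have hp1 : ‖p‖ = 1 := norm_smul_inv_norm ha0
  have hq1 : ‖q‖ = 1 := norm_smul_inv_norm hw
  have hpq : inner ℝ p q < 1 := (inner_lt_one_iff_real_of_norm_eq_one hp1 hq1).2 hne
  have hap : a = ‖a‖ • p := by
    rw [hp, smul_smul, mul_inv_cancel₀ (norm_ne_zero_iff.2 ha0), one_smul]
  have hwq : w = ‖w‖ • q := by
    rw [hq, smul_smul, mul_inv_cancel₀ (norm_ne_zero_iff.2 hw), one_smul]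
  have hav : inner ℝ a (q - p) < 0 := by
    rw [hap, real_inner_smul_left, inner_sub_right, real_inner_self_eq_norm_sq, hp1]
    exact mul_neg_of_pos_of_neg (norm_pos_iff.2 ha0) (by linarith)
  have hwv : inner ℝ (-w) (q - p) < 0 := by
    rw [hwq, inner_neg_left, real_inner_smul_left, inner_sub_right, real_inner_self_eq_norm_sq,
      hq1, real_inner_comm]
    have : 0 < ‖w‖ * (1 ^ 2 - inner ℝ p q) :=
      mul_pos (norm_pos_iff.2 hw) (by linarith)
    linarith
  have hneg : HasGradientAt (fun y => -h y) (-w) x := by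
    rw [hasGradientAt_iff_hasFDerivAt, map_neg]
    exact hh.hasFDerivAt.neg
  have e1 := eventually_add_smul_neg hga hg0 hav
  have e2 := eventually_add_smul_neg hneg (by simp [hh0]) hwv
  have hline : Tendsto (fun t : ℝ => x + t • (q - p)) (𝓝[>] 0) (𝓝 x) := by
    have : Continuous fun t : ℝ => x + t • (q - p) := by fun_prop
    simpa using (this.tendsto 0).mono_left nhdsWithin_le_nhds
  obtain ⟨t, h1, h2, h3, h4⟩ :=
    (e1.and (e2.and ((hline.eventually hgdef).and (hline.eventually hdef)))).exists
  have := h4.1 (h3.2 h1)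
  linarith

end OuterNormal

/-! ### Orthogonal coordinates adapted to a direction -/

section Splitting

variable {E F : Type*} [NormedAddCommGroup E] [InnerProductSpace ℝ E] [NormedAddCommGroup F]
  [InnerProductSpace ℝ F]

/-- `T` identifies `E` with the orthogonal sum of `F` and a line. -/
def IsOrthogonalSplitting (T : (F × ℝ) ≃L[ℝ] E) : Prop :=
  ∀ p q : F × ℝ, inner ℝ (T p) (T q) = inner ℝ p.1 q.1 + p.2 * q.2

theorem IsOrthogonalSplitting.norm_sq {T : (F × ℝ) ≃L[ℝ] E} (hT : IsOrthogonalSplitting T)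
    (p : F × ℝ) : ‖T p‖ ^ 2 = ‖p.1‖ ^ 2 + p.2 ^ 2 := by
  rw [← real_inner_self_eq_norm_sq, hT, real_inner_self_eq_norm_sq, sq p.2]

/-- `F × ℝ` carries the sup norm, so `T` is isometric only after passing to `WithLp 2`; that passage
preserves volume, and so do linear isometries. -/
theorem IsOrthogonalSplitting.measurePreserving [FiniteDimensional ℝ E]
    [FiniteDimensional ℝ F] [MeasurableSpace E] [BorelSpace E]
    [MeasurableSpace F] [BorelSpace F] {T : (F × ℝ) ≃L[ℝ] E} (hT : IsOrthogonalSplitting T) :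
    MeasurePreserving T volume volume := by
  let S : WithLp 2 (F × ℝ) ≃ₗᵢ[ℝ] E :=
    { (WithLp.linearEquiv 2 ℝ (F × ℝ)).trans T.toLinearEquiv with
      norm_map' := fun p => by
        have h1 := hT.norm_sq p.ofLp
        have h2 := WithLp.prod_norm_sq_eq_of_L2 p
        rw [← sq_eq_sq₀ (norm_nonneg _) (norm_nonneg _), h2]
        simpa using h1 }
  exact S.measurePreserving.comp (WithLp.volume_preserving_toLp F ℝ)

theorem exists_isOrthogonalSplitting [FiniteDimensional ℝ E] {m : ℕ} (hE : finrank ℝ E = m + 1) {v : E} (hv : ‖v‖ = 1) :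
    ∃ T : (Euc m × ℝ) ≃L[ℝ] E, IsOrthogonalSplitting T ∧ T (0, 1) = v := by
  have hv0 : v ≠ 0 := norm_ne_zero_iff.1 (by rw [hv]; exact one_ne_zero)
  have : Fact (finrank ℝ E = m + 1) := ⟨hE⟩
  let b := OrthonormalBasis.fromOrthogonalSpanSingleton (𝕜 := ℝ) m hv0
  let ι : Euc m →ₗᵢ[ℝ] E := (ℝ ∙ v)ᗮ.subtypeₗᵢ.comp b.repr.symm.toLinearIsometry
  have hι : ∀ y, inner ℝ (ι y) v = 0 := fun y => by
    have := (b.repr.symm y).2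
    rw [Submodule.mem_orthogonal_singleton_iff_inner_left] at this
    exact this
  let f : (Euc m × ℝ) →ₗ[ℝ] E := ι.toLinearMap.coprod (LinearMap.toSpanSingleton ℝ E v)
  have hf : ∀ p, f p = ι p.1 + p.2 • v := fun p => by simp [f]
  have hinner : ∀ p q, inner ℝ (f p) (f q) = inner ℝ p.1 q.1 + p.2 * q.2 := by
    intro p q
    rw [hf, hf, inner_add_left, inner_add_right, inner_add_right, real_inner_smul_left,
      real_inner_smul_left, real_inner_smul_right, real_inner_smul_right, hι, real_inner_comm (ι q.1) v, hι,
      real_inner_self_eq_norm_sq, hv, ι.inner_map_map]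
    ring
  have hinj : Function.Injective f := by
    rw [injective_iff_map_eq_zero]
    intro p hp
    have h1 := hinner p p
    rw [hp, inner_zero_left, real_inner_self_eq_norm_sq] at h1
    have h2 : ‖p.1‖ = 0 := by nlinarith [sq_nonneg ‖p.1‖, mul_self_nonneg p.2]
    have h3 : p.2 = 0 := by nlinarith [sq_nonneg ‖p.1‖, mul_self_nonneg p.2]
    exact Prod.ext (norm_eq_zero.1 h2) h3
  have hrank : finrank ℝ (Euc m × ℝ) = finrank ℝ E := by
    rw [hE, finrank_prod, finrank_euclideanSpace_fin, finrank_self]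
  refine ⟨(LinearEquiv.ofInjectiveOfFinrankEq f hinj hrank).toContinuousLinearEquiv,
    fun p q => hinner p q, ?_⟩
  change f (0, 1) = v
  simp [hf]

end Splitting

theorem ContinuousOn.measurable_indicator {α β : Type*} [TopologicalSpace α] [MeasurableSpace α]
    [OpensMeasurableSpace α] [TopologicalSpace β] [MeasurableSpace β] [BorelSpace β] [Zero β]
    {f : α → β} {s : Set α} (hf : ContinuousOn f s) (hs : MeasurableSet s) :
    Measurable (s.indicator f) := by
  classical
  rw [← Set.piecewise_eq_indicator]
  exact hf.measurable_piecewise continuousOn_const hs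

/-! ### Domains that lie below a graph -/

section LocalGraph

variable {E F : Type*} [NormedAddCommGroup E] [InnerProductSpace ℝ E] [NormedAddCommGroup F]
  [InnerProductSpace ℝ F] [MeasurableSpace F]

/-- In the box `B × I`, in the coordinates `T`, the set `Ω` is the region below the graph of a
`C²` Lipschitz function `φ`. -/
structure IsLocalGraph (Ω : Set E) (T : (F × ℝ) ≃L[ℝ] E) (B : Set F) (I : Set ℝ) (φ : F → ℝ) :
    Prop where
  isOpen_base : IsOpen B
  isOpen_interval : IsOpen I
  contDiffOn : ContDiffOn ℝ 2 φ B
  lipschitz : ∃ K, LipschitzOnWith K φ B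
  measurable : Measurable φ
  mapsTo : ∀ y ∈ B, φ y ∈ I
  mem_iff : ∀ y ∈ B, ∀ s ∈ I, T (y, s) ∈ Ω ↔ s < φ y

namespace IsLocalGraph

variable {Ω : Set E} {T : (F × ℝ) ≃L[ℝ] E} {B : Set F} {I : Set ℝ} {φ : F → ℝ}

theorem contDiffAt (h : IsLocalGraph Ω T B I φ) {y : F} (hy : y ∈ B) : ContDiffAt ℝ 2 φ y :=
  h.contDiffOn.contDiffAt (h.isOpen_base.mem_nhds hy)

theorem isOpen_box (h : IsLocalGraph Ω T B I φ) : IsOpen (T.symm ⁻¹' (B ×ˢ I)) :=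
  (h.isOpen_base.prod h.isOpen_interval).preimage T.symm.continuous

/-- By continuity of `φ`, a point strictly above the graph has a neighbourhood that misses `Ω`,
while a point of the graph is a limit of points below it. -/
theorem mem_frontier_iff (h : IsLocalGraph Ω T B I φ) (hΩ : IsOpen Ω) {y : F} (hy : y ∈ B) {s : ℝ}
    (hs : s ∈ I) : T (y, s) ∈ frontier Ω ↔ s = φ y := by
  rw [hΩ.frontier_eq]
  constructor
  · rintro ⟨h1, h2⟩
    rw [h.mem_iff y hy s hs, not_lt] at h2
    refine le_antisymm ?_ h2
    by_contra hlt
    rw [not_le] at hlt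
    have hcont : ContinuousAt φ (y, s).1 := (h.contDiffAt hy).continuousAt
    have hev : ∀ᶠ p : F × ℝ in 𝓝 (y, s), T p ∉ Ω := by
      have e1 : ∀ᶠ p : F × ℝ in 𝓝 (y, s), φ p.1 < p.2 :=
        (hcont.comp continuousAt_fst).eventually_lt continuousAt_snd hlt
      filter_upwards [e1, (h.isOpen_base.prod h.isOpen_interval).mem_nhds (mk_mem_prod hy hs)]
        with p hp hpB
      rw [h.mem_iff p.1 hpB.1 p.2 hpB.2]
      exact hp.le.not_gt
    have hev' : ∀ᶠ z in 𝓝 (T (y, s)), z ∉ Ω := by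
      have := (T.symm.continuous.tendsto (T (y, s)))
      rw [T.symm_apply_apply] at this
      filter_upwards [this.eventually hev] with z hz
      simpa using hz
    exact (mem_closure_iff_frequently.1 h1) hev'
  · rintro rfl
    refine ⟨?_, fun hmem => lt_irrefl _ ((h.mem_iff y hy _ hs).1 hmem)⟩
    have hlim : Tendsto (fun t : ℝ => T (y, t)) (𝓝[<] φ y) (𝓝 (T (y, φ y))) := by
      have : Continuous fun t : ℝ => T (y, t) := by fun_prop
      exact (this.tendsto _).mono_left nhdsWithin_le_nhds
    refine mem_closure_of_tendsto hlim ?_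
    filter_upwards [self_mem_nhdsWithin,
      mem_nhdsWithin_of_mem_nhds (h.isOpen_interval.mem_nhds hs)] with t ht htI
    exact (h.mem_iff y hy t htI).2 ht

theorem frontier_inter_box (h : IsLocalGraph Ω T B I φ) (hΩ : IsOpen Ω) :
    frontier Ω ∩ T.symm ⁻¹' (B ×ˢ I) = (fun y => T (y, φ y)) '' B := by
  ext x
  obtain ⟨⟨y, s⟩, rfl⟩ := T.surjective x
  simp only [mem_inter_iff, mem_preimage, ContinuousLinearEquiv.symm_apply_apply, mem_prod,
    mem_image]
  constructor
  · rintro ⟨h1, hy, hs⟩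
    exact ⟨y, hy, by rw [(h.mem_frontier_iff hΩ hy hs).1 h1]⟩
  · rintro ⟨z, hz, hzs⟩
    obtain ⟨rfl, rfl⟩ := Prod.mk.inj (T.injective hzs)
    exact ⟨(h.mem_frontier_iff hΩ hz (h.mapsTo z hz)).2 rfl, hz, h.mapsTo z hz⟩

end IsLocalGraph

/-- The implicit function theorem in the form of a graph chart: near a zero with positive partial
derivative in the last variable, the negative set of a `C²` function lies below a graph. -/
theorem exists_graph_of_partial_pos [CompleteSpace F] [BorelSpace F] {f : F × ℝ → ℝ} {p : F × ℝ}
    (hf : ContDiffAt ℝ 2 f p) (hp : f p = 0) (hpos : 0 < fderiv ℝ f p (0, 1))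
    {N : Set (F × ℝ)} (hN : N ∈ 𝓝 p) :
    ∃ (r₁ r₂ : ℝ) (φ : F → ℝ), 0 < r₁ ∧ 0 < r₂ ∧ ball p.1 r₁ ×ˢ ball p.2 r₂ ⊆ N ∧
      ContDiffOn ℝ 2 φ (ball p.1 r₁) ∧ (∃ K, LipschitzOnWith K φ (ball p.1 r₁)) ∧ Measurable φ ∧
      (∀ y ∈ ball p.1 r₁, φ y ∈ ball p.2 r₂) ∧
      ∀ y ∈ ball p.1 r₁, ∀ s ∈ ball p.2 r₂, f (y, s) < 0 ↔ s < φ y := by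
  have hinv : (fderiv ℝ f p ∘L .inr ℝ F ℝ).IsInvertible := by
    refine ⟨ContinuousLinearEquiv.unitsEquivAut ℝ (Units.mk0 _ hpos.ne'), ?_⟩
    ext
    simp
  have h2 : (2 : ℕ∞ω) ≠ 0 := by norm_num
  set φ := hf.implicitFunction h2 hinv with hφ
  have hφp : φ p.1 = p.2 := hf.implicitFunction_apply_self h2 hinv
  have hφC : ContDiffAt ℝ 2 φ p.1 := hf.contDiffAt_implicitFunction h2 hinv
  have hφf : ∀ᶠ y in 𝓝 p.1, f (y, φ y) = 0 := by
    have := hf.eventually_apply_implicitFunction h2 hinv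
    rwa [hp] at this
  have hdpos : ∀ᶠ q in 𝓝 p, 0 < fderiv ℝ f q (0, 1) := by
    have hc : ContinuousAt (fun q => fderiv ℝ f q (0, 1)) p :=
      ((hf.fderiv_right (m := 1) (by norm_num)).continuousAt).clm_apply continuousAt_const
    exact hc.eventually (lt_mem_nhds hpos)
  have hC : ∀ᶠ q in 𝓝 p, ContDiffAt ℝ 2 f q := hf.eventually (by simp)
  obtain ⟨r, hr, hbox⟩ := Metric.eventually_nhds_iff_ball.1 (hdpos.and (hC.and hN))
  rw [← ball_prod_same] at hbox
  obtain ⟨K, t, ht, hlip⟩ := (hφC.of_le (by norm_num : (1 : ℕ∞ω) ≤ 2)).exists_lipschitzOnWith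
  have hφball : ∀ᶠ y in 𝓝 p.1, φ y ∈ ball p.2 r := by
    refine hφC.continuousAt.eventually ?_
    rw [hφp]
    exact ball_mem_nhds _ hr
  obtain ⟨r', hr', hball⟩ := Metric.eventually_nhds_iff_ball.1
    (hφf.and (hφball.and ((hφC.eventually (by simp)).and ht)))
  have hsub : ball p.1 (min r r') ⊆ ball p.1 r' := ball_subset_ball (min_le_right _ _)
  have hsub' : ball p.1 (min r r') ⊆ ball p.1 r := ball_subset_ball (min_le_left _ _)
  have hφD : ContDiffOn ℝ 2 φ (ball p.1 (min r r')) :=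
    fun y hy => (hball y (hsub hy)).2.2.1.contDiffWithinAt
  have hind : EqOn ((ball p.1 (min r r')).indicator φ) φ (ball p.1 (min r r')) :=
    fun y hy => indicator_of_mem hy φ
  -- The implicit function is controlled only near `p.1`. Setting it to zero elsewhere makes it
  -- measurable on all of `F`, as the global shear along the graph requires.
  refine ⟨min r r', r, (ball p.1 (min r r')).indicator φ, lt_min hr hr', hr, ?_,
    hφD.congr hind, ⟨K, ?_⟩, ?_, ?_, ?_⟩
  · exact fun q hq => (hbox q ⟨hsub' hq.1, hq.2⟩).2.2
  · intro y hy z hz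
    rw [hind hy, hind hz]
    exact hlip (hball y (hsub hy)).2.2.2 (hball z (hsub hz)).2.2.2
  · exact hφD.continuousOn.measurable_indicator measurableSet_ball
  · intro y hy
    rw [hind hy]
    exact (hball y (hsub hy)).2.1
  · intro y hy s hs
    rw [hind hy]
    have hderiv : ∀ s ∈ ball p.2 r,
        HasDerivAt (fun s => f (y, s)) (fderiv ℝ f (y, s) (0, 1)) s := by
      intro s hs
      have hfd := ((hbox (y, s) ⟨hsub' hy, hs⟩).2.1.differentiableAt (by norm_num)).hasFDerivAt
      exact hfd.comp_hasDerivAt s ((hasDerivAt_const s y).prodMk (hasDerivAt_id s))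
    have hmono : StrictMonoOn (fun s => f (y, s)) (ball p.2 r) := by
      refine strictMonoOn_of_deriv_pos (convex_ball _ _)
        (fun s hs => (hderiv s hs).continuousAt.continuousWithinAt) fun s hs => ?_
      rw [isOpen_ball.interior_eq] at hs
      rw [(hderiv s hs).deriv]
      exact (hbox (y, s) ⟨hsub' hy, hs⟩).1
    have hzero := (hball y (hsub hy)).1
    rw [← hmono.lt_iff_lt hs (hball y (hsub hy)).2.1]
    simp only [hzero]

end LocalGraph

/-! ### Graph charts of a smooth domain -/

section SmoothDomain

variable {d m : ℕ} {Ω : Set (Euc d)}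

/-- Near each boundary point a smooth domain lies below a graph. -/
theorem IsSmoothBoundedDomain.exists_isLocalGraph (hΩ : IsSmoothBoundedDomain Ω) (hd : d = m + 1)
    {x : Euc d} (hx : x ∈ frontier Ω) :
    ∃ (T : (Euc m × ℝ) ≃L[ℝ] Euc d) (B : Set (Euc m)) (I : Set ℝ) (φ : Euc m → ℝ),
      IsOrthogonalSplitting T ∧ IsLocalGraph Ω T B I φ ∧ x ∈ T.symm ⁻¹' (B ×ˢ I) := by
  obtain ⟨g, U, hU, hxU, hg, hgrad, hΩU⟩ := hΩ.smooth_boundary x hx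
  have hw := hgrad x hxU
  set w := gradient g x with hwdef
  have hgC : ContDiffAt ℝ 2 g x :=
    (hg.contDiffAt (hU.mem_nhds hxU)).of_le (WithTop.coe_le_coe.2 (le_top : (2 : ℕ∞) ≤ ⊤))
  have hga : HasGradientAt g w x := (hgC.differentiableAt (by norm_num)).hasGradientAt
  have hiff : ∀ y ∈ U, y ∈ Ω ↔ g y < 0 := by
    intro y hy
    have := Set.ext_iff.1 hΩU y
    simpa only [mem_inter_iff, hy, and_true, mem_ofPred_eq, true_and] using this
  have hg0 : g x = 0 := eq_zero_of_mem_frontier hΩ.isOpen hx hga.continuousAt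
    (mem_of_superset (hU.mem_nhds hxU) hiff)
  -- With the last axis along the gradient, the partial derivative of `g ∘ T` in that variable is
  -- `‖w‖ > 0`.
  obtain ⟨T, hT, hTv⟩ := exists_isOrthogonalSplitting (E := Euc d) (m := m)
    (by rw [finrank_euclideanSpace_fin, hd]) (norm_smul_inv_norm (𝕜 := ℝ) hw)
  have hTx : T (T.symm x) = x := T.apply_symm_apply x
  have hfC : ContDiffAt ℝ 2 (g ∘ T) (T.symm x) := by
    refine ContDiffAt.comp _ ?_ T.contDiff.contDiffAt
    rwa [hTx]
  have hfd : fderiv ℝ (g ∘ T) (T.symm x) (0, 1) = ‖w‖ := by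
    have h1 : HasFDerivAt g (InnerProductSpace.toDual ℝ _ w) (T (T.symm x)) := by
      rw [hTx]; exact hga.hasFDerivAt
    rw [(h1.comp (T.symm x) T.hasFDerivAt).fderiv]
    change inner ℝ w (T (0, 1)) = ‖w‖
    rw [hTv, real_inner_smul_right, real_inner_self_eq_norm_sq]
    have : ‖w‖ ≠ 0 := norm_ne_zero_iff.2 hw
    simp only [RCLike.ofReal_real_eq_id, id]
    field_simp
  obtain ⟨r₁, r₂, φ, hr₁, hr₂, hsub, hφC, hφL, hφm, hφI, hφiff⟩ :=
    exists_graph_of_partial_pos hfC (by simp [hTx, hg0]) (hfd ▸ norm_pos_iff.2 hw)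
      (N := T ⁻¹' U) (T.continuous.continuousAt.preimage_mem_nhds
        (hU.mem_nhds (by rwa [hTx])))
  refine ⟨T, ball (T.symm x).1 r₁, ball (T.symm x).2 r₂, φ, hT,
    ⟨isOpen_ball, isOpen_ball, hφC, hφL, hφm, hφI, fun y hy s hs => ?_⟩,
    mem_ball_self hr₁, mem_ball_self hr₂⟩
  rw [← hφiff y hy s hs]
  exact hiff _ (hsub (mk_mem_prod hy hs))

/-- The outer normal along a graph. -/
theorem IsLocalGraph.outerNormal_eq {T : (Euc m × ℝ) ≃L[ℝ] Euc d} {B : Set (Euc m)} {I : Set ℝ}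
    {φ : Euc m → ℝ} (h : IsLocalGraph Ω T B I φ) (hT : IsOrthogonalSplitting T)
    (hΩ : IsSmoothBoundedDomain Ω) {y : Euc m} (hy : y ∈ B) :
    outerNormal Ω (T (y, φ y)) =
      (√(1 + ‖gradient φ y‖ ^ 2))⁻¹ • T (-gradient φ y, 1) := by
  have hx : T (y, φ y) ∈ frontier Ω :=
    (h.mem_frontier_iff hΩ.isOpen hy (h.mapsTo y hy)).2 rfl
  have hnorm : ‖T (-gradient φ y, 1)‖ = √(1 + ‖gradient φ y‖ ^ 2) := by
    rw [← Real.sqrt_sq (norm_nonneg (T _)), hT.norm_sq, norm_neg]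
    congr 1; ring
  have hpos : 0 < √(1 + ‖gradient φ y‖ ^ 2) := by positivity
  rw [← hnorm]
  have hφ : HasFDerivAt φ (fderiv ℝ φ y) (T.symm (T (y, φ y))).1 := by
    rw [T.symm_apply_apply]
    exact ((h.contDiffAt hy).differentiableAt (by norm_num)).hasFDerivAt
  -- The height above the graph is a defining function with gradient `T (-∇φ, 1)`. It is only `C²`,
  -- which is why `outerNormal_eq` asks for no smoothness.
  refine _root_.outerNormal_eq hΩ.isOpen hx (hΩ.smooth_boundary _ hx)
    (h := fun z => (T.symm z).2 - φ (T.symm z).1) ?_ ?_ ?_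
  · rw [← norm_pos_iff, hnorm]; exact hpos
  · rw [hasGradientAt_iff_hasFDerivAt]
    have h1 : HasFDerivAt (fun z => (T.symm z).1)
        ((ContinuousLinearMap.fst ℝ (Euc m) ℝ) ∘L (T.symm : Euc d →L[ℝ] Euc m × ℝ))
        (T (y, φ y)) := T.symm.hasFDerivAt.fst
    have h2 : HasFDerivAt (fun z => (T.symm z).2)
        ((ContinuousLinearMap.snd ℝ (Euc m) ℝ) ∘L (T.symm : Euc d →L[ℝ] Euc m × ℝ))
        (T (y, φ y)) := T.symm.hasFDerivAt.snd
    refine (h2.sub (hφ.comp (T (y, φ y)) h1)).congr_fderiv ?_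
    refine ContinuousLinearMap.ext fun z => ?_
    obtain ⟨⟨a, s⟩, rfl⟩ := T.surjective z
    have : fderiv ℝ φ y a = inner ℝ (gradient φ y) a := by
      rw [gradient, InnerProductSpace.toDual_symm_apply]
    have h3 : (InnerProductSpace.toDual ℝ (Euc d)) (T (-gradient φ y, 1)) (T (a, s)) =
        -inner ℝ (gradient φ y) a + s := by
      rw [InnerProductSpace.toDual_apply_apply, hT, inner_neg_left, one_mul]
    rw [h3, ← this]
    simp only [sub_apply, ContinuousLinearMap.comp_apply,
      ContinuousLinearEquiv.coe_coe, T.symm_apply_apply, ContinuousLinearMap.coe_snd',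
      ContinuousLinearMap.coe_fst']
    ring
  · filter_upwards [h.isOpen_box.mem_nhds (show T.symm (T (y, φ y)) ∈ B ×ˢ I by
      rw [T.symm_apply_apply]; exact ⟨hy, h.mapsTo y hy⟩)] with z hz
    have := h.mem_iff _ hz.1 _ hz.2
    rw [Prod.mk.eta, T.apply_symm_apply] at this
    rw [this, sub_neg]

end SmoothDomain

/-! ### Surface integrals and tangential derivatives on a graph -/

section GraphParametrization

variable {E F : Type*} [NormedAddCommGroup E] [InnerProductSpace ℝ E] [NormedAddCommGroup F]
  [InnerProductSpace ℝ F] {T : (F × ℝ) ≃L[ℝ] E}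

/-- The derivative of the parametrisation `y ↦ T (y, φ y)` of a graph. -/
noncomputable def graphDeriv (T : (F × ℝ) ≃L[ℝ] E) (φ : F → ℝ) (y : F) : F →L[ℝ] E :=
  (T : F × ℝ →L[ℝ] E) ∘L (ContinuousLinearMap.id ℝ F).prod (fderiv ℝ φ y)

theorem graphDeriv_apply (φ : F → ℝ) (y z : F) : graphDeriv T φ y z = T (z, fderiv ℝ φ y z) := rfl

theorem hasStrictFDerivAt_graph {φ : F → ℝ} {y : F} (h : ContDiffAt ℝ 2 φ y) :
    HasStrictFDerivAt (fun y => T (y, φ y)) (graphDeriv T φ y) y :=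
  T.hasStrictFDerivAt.comp y
    ((hasStrictFDerivAt_id y).prodMk (h.hasStrictFDerivAt (by norm_num)))

theorem fderiv_eq_inner_gradient [CompleteSpace F] (φ : F → ℝ) (y z : F) :
    fderiv ℝ φ y z = inner ℝ (gradient φ y) z := by
  rw [gradient, InnerProductSpace.toDual_symm_apply]

theorem IsOrthogonalSplitting.norm_le_norm_graphDeriv (hT : IsOrthogonalSplitting T) (φ : F → ℝ)
    (y z : F) : ‖z‖ ≤ ‖graphDeriv T φ y z‖ := by
  rw [← sq_le_sq₀ (norm_nonneg _) (norm_nonneg _), graphDeriv_apply, hT.norm_sq]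
  exact le_add_of_nonneg_right (sq_nonneg _)

/-- The Gram operator of the parametrisation is the identity plus the rank-one map `a ↦ dφ(a) ∇φ`,
whose determinant is `1 + dφ(∇φ)`. -/
theorem IsOrthogonalSplitting.normDet_graphDeriv [FiniteDimensional ℝ E] [FiniteDimensional ℝ F]
    (hT : IsOrthogonalSplitting T) (φ : F → ℝ) (y : F) :
    (graphDeriv T φ y : F →ₗ[ℝ] E).normDet = √(1 + ‖gradient φ y‖ ^ 2) := by
  rw [← Real.sqrt_sq (LinearMap.normDet_nonneg _)]
  congr 1
  have h1 := (graphDeriv T φ y : F →ₗ[ℝ] E).normDet_sq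
  simp only [RCLike.ofReal_real_eq_id, id] at h1
  rw [h1]
  have h2 : LinearMap.adjoint (graphDeriv T φ y : F →ₗ[ℝ] E) ∘ₗ (graphDeriv T φ y : F →ₗ[ℝ] E) =
      LinearMap.transvection (fderiv ℝ φ y : F →ₗ[ℝ] ℝ) (gradient φ y) := by
    refine LinearMap.ext fun a => ext_inner_right ℝ fun b => ?_
    rw [LinearMap.comp_apply, LinearMap.adjoint_inner_left, LinearMap.transvection.apply,
      inner_add_left, real_inner_smul_left, ← fderiv_eq_inner_gradient]
    exact hT _ _
  rw [h2, LinearMap.transvection.det]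
  change 1 + fderiv ℝ φ y (gradient φ y) = _
  rw [fderiv_eq_inner_gradient, real_inner_self_eq_norm_sq]

theorem lipschitzOnWith_graph {φ : F → ℝ} {B : Set F} {K : ℝ≥0}
    (h : LipschitzOnWith K φ B) :
    ∃ C, LipschitzOnWith C (fun y => T (y, φ y)) B :=
  ⟨_, (T : F × ℝ →L[ℝ] E).lipschitz.comp_lipschitzOnWith
    ((LipschitzWith.id.lipschitzOnWith (s := B)).prodMk h)⟩

end GraphParametrization

namespace IsLocalGraph

variable {d m : ℕ} {Ω : Set (Euc d)} {T : (Euc m × ℝ) ≃L[ℝ] Euc d} {B : Set (Euc m)} {I : Set ℝ}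
    {φ : Euc m → ℝ}

theorem continuousOn_gradient (h : IsLocalGraph Ω T B I φ) : ContinuousOn (gradient φ) B := by
  intro y hy
  have : ContinuousAt (fderiv ℝ φ) y :=
    ((h.contDiffAt hy).fderiv_right (m := 1) (by norm_num)).continuousAt
  exact ((InnerProductSpace.toDual ℝ (Euc m)).symm.continuous.continuousAt.comp
    this).continuousWithinAt

theorem continuousOn_areaFactor (h : IsLocalGraph Ω T B I φ) :
    ContinuousOn (fun y => √(1 + ‖gradient φ y‖ ^ 2)) B :=
  (continuousOn_const.add (h.continuousOn_gradient.norm.pow 2)).sqrt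

theorem measurableSet_image_graph (h : IsLocalGraph Ω T B I φ) (hΩ : IsOpen Ω) :
    MeasurableSet ((fun y => T (y, φ y)) '' B) := by
  rw [← h.frontier_inter_box hΩ]
  exact isClosed_frontier.measurableSet.inter h.isOpen_box.measurableSet

theorem map_restrict_hausdorff (h : IsLocalGraph Ω T B I φ) (hT : IsOrthogonalSplitting T) :
    ((μHE[m] : Measure (Euc d)).restrict ((fun y => T (y, φ y)) '' B)).map
        (fun x => (T.symm x).1) =
      (volume.restrict B).withDensity (fun y => ENNReal.ofReal √(1 + ‖gradient φ y‖ ^ 2)) := by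
  obtain ⟨K, hK⟩ := h.lipschitz
  obtain ⟨C, hC⟩ := lipschitzOnWith_graph (T := T) hK
  have hmeas : Measurable fun x => (T.symm x).1 :=
    (continuous_fst.comp T.symm.continuous).measurable
  have key := map_restrict_euclideanHausdorffMeasure_image h.isOpen_base
    (fun y hy => hasStrictFDerivAt_graph (T := T) (h.contDiffAt hy))
    (fun y _ => hT.norm_le_norm_graphDeriv φ y) hC hmeas (fun y _ => by simp)
  rw [finrank_euclideanSpace_fin] at key
  rw [key]
  simp only [hT.normDet_graphDeriv]

/-- Surface integrals of functions supported in a graph chart, in the coordinates of the chart. -/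
theorem surfaceMeasure_integral (h : IsLocalGraph Ω T B I φ) (hT : IsOrthogonalSplitting T)
    (hΩ : IsOpen Ω) (hd : d = m + 1) {f : Euc d → ℝ} (hf : ∀ x ∉ T.symm ⁻¹' (B ×ˢ I), f x = 0)
    (hfm : AEStronglyMeasurable (fun y => f (T (y, φ y))) (volume.restrict B)) :
    ∫ x, f x ∂(surfaceMeasure Ω) = ∫ y in B, √(1 + ‖gradient φ y‖ ^ 2) * f (T (y, φ y)) ∧
    (IntegrableOn (fun y => √(1 + ‖gradient φ y‖ ^ 2) * f (T (y, φ y))) B →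
      Integrable f (surfaceMeasure Ω)) := by
  have hdm : d - 1 = m := by omega
  have hP : Measurable fun x => (T.symm x).1 :=
    (continuous_fst.comp T.symm.continuous).measurable
  set S := (fun y => T (y, φ y)) '' B with hS
  have hSm : MeasurableSet S := h.measurableSet_image_graph hΩ
  have hSf : S ⊆ frontier Ω := (h.frontier_inter_box hΩ).symm.subset.trans inter_subset_left
  have hzero : ∀ x ∈ frontier Ω \ S, f x = 0 := by
    intro x hx
    refine hf x fun hbox => hx.2 ?_
    rw [hS, ← h.frontier_inter_box hΩ]
    exact ⟨hx.1, hbox⟩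
  -- On the graph `f` factors through the projection to the base, so only the pushforward of the
  -- Hausdorff measure matters.
  have heq : ∀ x ∈ S, f x = (fun y => f (T (y, φ y))) (T.symm x).1 := by
    rintro _ ⟨y, _, rfl⟩
    simp
  have hmap := h.map_restrict_hausdorff hT
  have hJm : AEMeasurable (fun y => ENNReal.ofReal √(1 + ‖gradient φ y‖ ^ 2))
      (volume.restrict B) :=
    (h.continuousOn_areaFactor.aemeasurable h.isOpen_base.measurableSet).ennreal_ofReal
  have hJtop : ∀ᵐ y ∂(volume.restrict B), ENNReal.ofReal √(1 + ‖gradient φ y‖ ^ 2) < ⊤ :=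
    Eventually.of_forall fun y => ENNReal.ofReal_lt_top
  have hfm' : AEStronglyMeasurable (fun y => f (T (y, φ y)))
      (((μHE[m] : Measure (Euc d)).restrict S).map (fun x => (T.symm x).1)) := by
    rw [hmap]
    exact hfm.mono_ac (withDensity_absolutelyContinuous _ _)
  have hsm : ∀ y, (ENNReal.ofReal √(1 + ‖gradient φ y‖ ^ 2)).toReal • f (T (y, φ y)) =
      √(1 + ‖gradient φ y‖ ^ 2) * f (T (y, φ y)) := fun y => by
    rw [ENNReal.toReal_ofReal (Real.sqrt_nonneg _), smul_eq_mul]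
  rw [surfaceMeasure, hdm]
  constructor
  · rw [setIntegral_eq_of_subset_of_forall_sdiff_eq_zero isClosed_frontier.measurableSet hSf hzero,
      setIntegral_congr_fun hSm heq, ← integral_map hP.aemeasurable hfm', hmap,
      integral_withDensity_eq_integral_toReal_smul₀ hJm hJtop]
    simp only [hsm]
  · intro hint
    have h1 : Integrable (fun y => f (T (y, φ y)))
        (((μHE[m] : Measure (Euc d)).restrict S).map (fun x => (T.symm x).1)) := by
      rw [hmap, integrable_withDensity_iff_integrable_smul₀' hJm hJtop]
      simp only [hsm]
      exact hint
    rw [integrable_map_measure hfm' hP.aemeasurable] at h1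
    have h2 : IntegrableOn f S μHE[m] :=
      (integrableOn_congr_fun heq hSm).2 h1
    exact h2.of_forall_sdiff_eq_zero isClosed_frontier.measurableSet hzero

/-- Derivatives within `∂Ω` are determined on tangent vectors. -/
theorem fderivWithin_frontier_eq (h : IsLocalGraph Ω T B I φ) (hT : IsOrthogonalSplitting T)
    (hΩ : IsSmoothBoundedDomain Ω) {y : Euc m} (hy : y ∈ B) {f k : Euc d → ℝ}
    {D : Euc d →L[ℝ] ℝ} (hf : DifferentiableWithinAt ℝ f (frontier Ω) (T (y, φ y)))
    (hk : HasFDerivWithinAt k D (closure Ω) (T (y, φ y))) (hfk : ∀ x ∈ frontier Ω, k x = f x)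
    {τ : Euc d} (hτ : inner ℝ (outerNormal Ω (T (y, φ y))) τ = 0) :
    fderivWithin ℝ f (frontier Ω) (T (y, φ y)) τ = D τ := by
  obtain ⟨⟨z, s⟩, rfl⟩ := T.surjective τ
  have hpos : 0 < √(1 + ‖gradient φ y‖ ^ 2) := by positivity
  -- Tangency means that `τ` is the velocity of the curve `t ↦ T (y + t z, φ (y + t z))` in `∂Ω`.
  -- Both sides of the goal are then the derivative of `f` along this curve, which is unique
  -- although derivatives within `∂Ω` are not.
  have hs : s = fderiv ℝ φ y z := by
    rw [h.outerNormal_eq hT hΩ hy, real_inner_smul_left, hT] at hτ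
    have := (mul_eq_zero.1 hτ).resolve_left (inv_pos.2 hpos).ne'
    simp only [inner_neg_left, one_mul] at this
    rw [fderiv_eq_inner_gradient]
    linarith
  have hx : T (y, φ y) ∈ frontier Ω :=
    (h.mem_frontier_iff hΩ.isOpen hy (h.mapsTo y hy)).2 rfl
  have hline : HasDerivAt (fun t : ℝ => y + t • z) z 0 := by
    simpa using ((hasDerivAt_id (0 : ℝ)).smul_const z).const_add y
  have hy0 : y + (0 : ℝ) • z = y := by simp
  have hcurve : HasDerivAt (fun t : ℝ => T (y + t • z, φ (y + t • z))) (T (z, s)) 0 := by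
    have h1 : HasFDerivAt (fun y => T (y, φ y)) (graphDeriv T φ y) (y + (0 : ℝ) • z) := by
      rw [hy0]
      exact (hasStrictFDerivAt_graph (h.contDiffAt hy)).hasFDerivAt
    have h2 := h1.comp_hasDerivAt (0 : ℝ) hline
    rwa [graphDeriv_apply, ← hs] at h2
  have hmem : ∀ᶠ t in 𝓝 (0 : ℝ), T (y + t • z, φ (y + t • z)) ∈ frontier Ω := by
    have : ∀ᶠ t in 𝓝 (0 : ℝ), y + t • z ∈ B :=
      hline.continuousAt.eventually (h.isOpen_base.mem_nhds (by simpa using hy))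
    filter_upwards [this] with t ht
    exact (h.mem_frontier_iff hΩ.isOpen ht (h.mapsTo _ ht)).2 rfl
  have hfx : HasFDerivWithinAt f (fderivWithin ℝ f (frontier Ω) (T (y, φ y))) (frontier Ω)
      (T (y + (0 : ℝ) • z, φ (y + (0 : ℝ) • z))) := by
    rw [hy0]; exact hf.hasFDerivWithinAt
  have hkx : HasFDerivWithinAt f D (frontier Ω)
      (T (y + (0 : ℝ) • z, φ (y + (0 : ℝ) • z))) := by
    rw [hy0]
    exact (hk.mono frontier_subset_closure).congr (fun x hx => (hfk x hx).symm) (hfk _ hx).symm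
  exact (hfx.comp_hasDerivAt (0 : ℝ) hcurve hmem).unique (hkx.comp_hasDerivAt (0 : ℝ) hcurve hmem)

end IsLocalGraph

/-- At a boundary point the tangent cone contains the open half-space of directions in which `g`
decreases, and this spans. The result gives continuity of `fderivWithin` up to the boundary. -/
theorem IsSmoothBoundedDomain.uniqueDiffOn_closure {d : ℕ} {Ω : Set (Euc d)}
    (hΩ : IsSmoothBoundedDomain Ω) : UniqueDiffOn ℝ (closure Ω) := by
  intro x hx
  rw [uniqueDiffWithinAt_closure]
  by_cases hxΩ : x ∈ Ω
  · exact hΩ.isOpen.uniqueDiffWithinAt hxΩ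
  have hxf : x ∈ frontier Ω := by rw [hΩ.isOpen.frontier_eq]; exact ⟨hx, hxΩ⟩
  obtain ⟨g, U, hU, hxU, hg, hgrad, hΩU⟩ := hΩ.smooth_boundary x hxf
  have hga : HasGradientAt g (gradient g x) x :=
    ((hg.contDiffAt (hU.mem_nhds hxU)).differentiableAt (by simp)).hasGradientAt
  have hdef : ∀ᶠ y in 𝓝 x, y ∈ Ω ↔ g y < 0 := by
    filter_upwards [hU.mem_nhds hxU] with y hy
    have := Set.ext_iff.1 hΩU y
    simpa only [mem_inter_iff, hy, and_true, mem_ofPred_eq, true_and] using this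
  have hg0 := eq_zero_of_mem_frontier hΩ.isOpen hxf hga.continuousAt hdef
  have hcone : {v : Euc d | inner ℝ (gradient g x) v < 0} ⊆ tangentConeAt ℝ Ω x := by
    intro v hv
    have hline : Tendsto (fun t : ℝ => x + t • v) (𝓝[>] 0) (𝓝 x) := by
      have : Continuous fun t : ℝ => x + t • v := by fun_prop
      simpa using (this.tendsto 0).mono_left nhdsWithin_le_nhds
    refine mem_tangentConeAt_of_add_smul_mem (l := 𝓝[>] (0 : ℝ)) (c := id) ?_ ?_
    · exact tendsto_id.mono_left (nhdsWithin_mono _ fun t (ht : 0 < t) => ht.ne')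
    · filter_upwards [eventually_add_smul_neg hga hg0 hv, hline.eventually hdef] with t h1 h2
      exact h2.2 h1
  have hopen : IsOpen {v : Euc d | inner ℝ (gradient g x) v < 0} :=
    isOpen_lt (by fun_prop) continuous_const
  have hne : -gradient g x ∈ {v : Euc d | inner ℝ (gradient g x) v < 0} := by
    have := norm_pos_iff.2 (hgrad x hxU)
    rw [mem_ofPred_eq, inner_neg_right, real_inner_self_eq_norm_sq]
    nlinarith
  have htop : Submodule.span ℝ (tangentConeAt ℝ Ω x) = ⊤ :=
    Submodule.eq_top_of_nonempty_interior' _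
      ⟨_, interior_maximal (hcone.trans Submodule.subset_span) hopen hne⟩
  exact ⟨by rw [htop]; exact dense_univ, hx⟩

/-! ### A one-dimensional cutoff -/

/-- A smooth function equal to `1` on `(-∞, -2]` and to `0` on `[-1, ∞)`. -/
noncomputable def stepCutoff (t : ℝ) : ℝ := Real.smoothTransition (-t - 1)

namespace stepCutoff

theorem contDiff {n : ℕ∞} : ContDiff ℝ n stepCutoff :=
  Real.smoothTransition.contDiff.comp (by fun_prop)

theorem eq_zero {t : ℝ} (h : -1 ≤ t) : stepCutoff t = 0 :=
  Real.smoothTransition.zero_of_nonpos (by linarith)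

theorem eq_one {t : ℝ} (h : t ≤ -2) : stepCutoff t = 1 :=
  Real.smoothTransition.one_of_one_le (by linarith)

theorem abs_le_one (t : ℝ) : |stepCutoff t| ≤ 1 := by
  rw [stepCutoff, abs_of_nonneg (Real.smoothTransition.nonneg _)]
  exact Real.smoothTransition.le_one _

theorem hasDerivAt (t : ℝ) : HasDerivAt stepCutoff (deriv stepCutoff t) t :=
  ((contDiff (n := 1)).differentiable (by norm_num) t).hasDerivAt

theorem continuous_deriv : Continuous (deriv stepCutoff) :=
  (contDiff (n := 1)).continuous_deriv le_rfl

theorem deriv_eq_zero {t : ℝ} (h : t ∉ Icc (-2 : ℝ) (-1)) : deriv stepCutoff t = 0 := by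
  rw [mem_Icc, not_and_or, not_le, not_le] at h
  rcases h with h | h
  · have : stepCutoff =ᶠ[𝓝 t] fun _ => 1 := by
      filter_upwards [Iio_mem_nhds h] with s hs using eq_one (le_of_lt hs)
    rw [this.deriv_eq, deriv_const]
  · have : stepCutoff =ᶠ[𝓝 t] fun _ => 0 := by
      filter_upwards [Ioi_mem_nhds h] with s hs using eq_zero (le_of_lt hs)
    rw [this.deriv_eq, deriv_const]

theorem hasCompactSupport_deriv : HasCompactSupport (deriv stepCutoff) :=
  HasCompactSupport.intro isCompact_Icc fun _ h => deriv_eq_zero h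

theorem integrable_deriv : Integrable (deriv stepCutoff) :=
  continuous_deriv.integrable_of_hasCompactSupport hasCompactSupport_deriv

theorem integral_deriv : ∫ t, deriv stepCutoff t = -1 := by
  have h1 : Tendsto stepCutoff atBot (𝓝 1) :=
    tendsto_const_nhds.congr' ((eventually_le_atBot (-2)).mono fun t ht => (eq_one ht).symm)
  have h2 : Tendsto stepCutoff atTop (𝓝 0) :=
    tendsto_const_nhds.congr' ((eventually_ge_atTop (-1)).mono fun t ht => (eq_zero ht).symm)
  rw [integral_of_hasDerivAt_of_tendsto hasDerivAt integrable_deriv h1 h2]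
  norm_num

end stepCutoff

/-! ### Coordinates that straighten a graph -/

section GraphCoordinates

variable {E F : Type*} [NormedAddCommGroup E] [InnerProductSpace ℝ E] [NormedAddCommGroup F]
  [InnerProductSpace ℝ F]

/-- The signed height of a point above the graph of `φ`. -/
noncomputable def graphHeight (T : (F × ℝ) ≃L[ℝ] E) (φ : F → ℝ) (x : E) : ℝ :=
  (T.symm x).2 - φ (T.symm x).1

/-- The derivative of `graphHeight`. -/
noncomputable def graphCovector (T : (F × ℝ) ≃L[ℝ] E) (φ : F → ℝ) (x : E) : E →L[ℝ] ℝ :=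
  ContinuousLinearMap.snd ℝ F ℝ ∘L (T.symm : E →L[ℝ] F × ℝ) -
    fderiv ℝ φ (T.symm x).1 ∘L ContinuousLinearMap.fst ℝ F ℝ ∘L (T.symm : E →L[ℝ] F × ℝ)

/-- Coordinates that straighten the graph of `φ`. -/
def graphShear (T : (F × ℝ) ≃L[ℝ] E) (φ : F → ℝ) (p : F × ℝ) : E := T (p.1, φ p.1 + p.2)

variable {T : (F × ℝ) ≃L[ℝ] E} {φ : F → ℝ}

theorem graphCovector_apply (x w : E) :
    graphCovector T φ x w = (T.symm w).2 - fderiv ℝ φ (T.symm x).1 (T.symm w).1 := rfl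

theorem graphHeight_graphShear (p : F × ℝ) : graphHeight T φ (graphShear T φ p) = p.2 := by
  simp [graphHeight, graphShear]

theorem symm_graphShear (p : F × ℝ) : T.symm (graphShear T φ p) = (p.1, φ p.1 + p.2) := by
  simp [graphShear]

theorem hasFDerivAt_graphHeight {x : E} (h : ContDiffAt ℝ 2 φ (T.symm x).1) :
    HasFDerivAt (graphHeight T φ) (graphCovector T φ x) x := by
  have h1 : HasFDerivAt (fun z => (T.symm z).1)
      ((ContinuousLinearMap.fst ℝ F ℝ) ∘L (T.symm : E →L[ℝ] F × ℝ)) x := T.symm.hasFDerivAt.fst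
  have h2 : HasFDerivAt (fun z => (T.symm z).2)
      ((ContinuousLinearMap.snd ℝ F ℝ) ∘L (T.symm : E →L[ℝ] F × ℝ)) x := T.symm.hasFDerivAt.snd
  have h3 : HasFDerivAt φ (fderiv ℝ φ (T.symm x).1) ((fun z => (T.symm z).1) x) :=
    (h.differentiableAt (by norm_num)).hasFDerivAt
  exact h2.sub (h3.comp x h1)

theorem contDiffAt_graphHeight {x : E} (h : ContDiffAt ℝ 2 φ (T.symm x).1) :
    ContDiffAt ℝ 2 (graphHeight T φ) x := by
  have h1 : ContDiffAt ℝ 2 (fun z => (T.symm z).1) x :=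
    (contDiff_fst.comp T.symm.contDiff).contDiffAt
  have h2 : ContDiffAt ℝ 2 (fun z => (T.symm z).2) x :=
    (contDiff_snd.comp T.symm.contDiff).contDiffAt
  exact h2.sub (ContDiffAt.comp x h h1)

variable [MeasurableSpace E] [BorelSpace E] [MeasurableSpace F] [BorelSpace F]

theorem measurable_graphHeight (hφ : Measurable φ) : Measurable (graphHeight T φ) :=
  (T.symm.continuous.measurable.snd).sub (hφ.comp T.symm.continuous.measurable.fst)

variable [FiniteDimensional ℝ F]

/-- The shear translates each vertical line by `φ y`, and Lebesgue measure is translation invariant.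
It allows slicing volume integrals along the translates of the graph. -/
theorem IsOrthogonalSplitting.measurePreserving_graphShear [FiniteDimensional ℝ E]
    (hT : IsOrthogonalSplitting T)
    (hφ : Measurable φ) :
    MeasurePreserving (graphShear T φ) ((volume : Measure F).prod (volume : Measure ℝ)) volume := by
  have h1 : MeasurePreserving (fun p : F × ℝ => (id p.1, φ p.1 + p.2))
      ((volume : Measure F).prod (volume : Measure ℝ))
      ((volume : Measure F).prod (volume : Measure ℝ)) :=
    (MeasurePreserving.id volume).skew_product (g := fun y t => φ y + t)
      ((hφ.comp measurable_fst).add measurable_snd)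
      (Eventually.of_forall fun y => map_add_left_eq_self volume (φ y))
  exact hT.measurePreserving.comp h1

theorem measurable_graphCovector_apply {G : E → E} (hG : Measurable G) :
    Measurable fun x => graphCovector T φ x (G x) := by
  have h1 : Measurable fun x => T.symm (G x) := T.symm.continuous.measurable.comp hG
  have h2 : Measurable fun x => fderiv ℝ φ (T.symm x).1 :=
    (measurable_fderiv ℝ φ).comp T.symm.continuous.measurable.fst
  have h3 : Measurable fun x => fderiv ℝ φ (T.symm x).1 (T.symm (G x)).1 :=
    (isBoundedBilinearMap_apply (𝕜 := ℝ) (E := F) (F := ℝ)).continuous.measurable.comp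
      (h2.prodMk h1.fst)
  exact h1.snd.sub h3

end GraphCoordinates

theorem MeasureTheory.integrable_of_bounded_of_isCompact {E : Type*} [TopologicalSpace E]
    [T2Space E] [MeasurableSpace E] [BorelSpace E] {μ : Measure E} [IsFiniteMeasureOnCompacts μ]
    {f : E → ℝ} {S : Set E} (hf : AEStronglyMeasurable f μ) {C : ℝ} (hC : ∀ x, |f x| ≤ C)
    (hS : IsCompact S) (h0 : ∀ x ∉ S, f x = 0) : Integrable f μ := by
  have h1 : IntegrableOn f S μ :=
    Measure.integrableOn_of_bounded hS.measure_lt_top.ne hf (M := C)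
      (Eventually.of_forall fun x => hC x)
  exact h1.integrable_of_forall_notMem_eq_zero h0

theorem fderiv_eq_zero_of_notMem_tsupport {E : Type*} [NormedAddCommGroup E] [NormedSpace ℝ E]
    {χ : E → ℝ} {x : E} (hx : x ∉ tsupport χ) : fderiv ℝ χ x = 0 := by
  by_contra hne
  exact hx (support_fderiv_subset ℝ hne)

theorem integrable_fderiv_apply {d : ℕ} {χ : Euc d → ℝ} {G : Euc d → Euc d} (hχ : ContDiff ℝ 2 χ)
    (hχc : HasCompactSupport χ) (hG : Measurable G) {M : ℝ} (hM : ∀ x, ‖G x‖ ≤ M) :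
    Integrable fun x => fderiv ℝ χ x (G x) := by
  have hχ' : Continuous (fderiv ℝ χ) := hχ.continuous_fderiv (by norm_num)
  obtain ⟨C, hC⟩ := hχ'.bounded_above_of_compact_support (hχc.fderiv ℝ)
  refine integrable_of_bounded_of_isCompact (C := C * M) ?_ (fun x => ?_) hχc.isCompact
    fun x hx => by rw [fderiv_eq_zero_of_notMem_tsupport hx]; rfl
  · exact ((isBoundedBilinearMap_apply (𝕜 := ℝ) (E := Euc d) (F := ℝ)).continuous.measurable.comp
      (hχ'.measurable.prodMk hG)).aestronglyMeasurable
  · exact (ContinuousLinearMap.le_opNorm _ _).trans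
      (mul_le_mul (hC x) (hM x) (norm_nonneg _) ((norm_nonneg _).trans (hC x)))

/-! ### Test functions cut off near the boundary -/

namespace IsLocalGraph

variable {d m : ℕ} {Ω : Set (Euc d)} {T : (Euc m × ℝ) ≃L[ℝ] Euc d} {B : Set (Euc m)} {I : Set ℝ}
    {φ : Euc m → ℝ} {χ : Euc d → ℝ} {G : Euc d → Euc d}

theorem mem_iff_graphHeight_neg (h : IsLocalGraph Ω T B I φ) {x : Euc d}
    (hx : x ∈ T.symm ⁻¹' (B ×ˢ I)) : x ∈ Ω ↔ graphHeight T φ x < 0 := by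
  have := h.mem_iff _ hx.1 _ hx.2
  rw [Prod.mk.eta, T.apply_symm_apply] at this
  rw [this, graphHeight, sub_neg]

/-- Cutting a test function off near the boundary. -/
theorem contDiff_cutoff (h : IsLocalGraph Ω T B I φ) (hχ : ContDiff ℝ 2 χ)
    (hχs : tsupport χ ⊆ T.symm ⁻¹' (B ×ˢ I)) (c : ℝ) :
    ContDiff ℝ 2 (fun x => χ x * stepCutoff (c * graphHeight T φ x)) := by
  rw [contDiff_iff_contDiffAt]
  intro x
  by_cases hx : x ∈ tsupport χ
  · have h1 := contDiffAt_graphHeight (T := T) (h.contDiffAt (hχs hx).1)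
    exact hχ.contDiffAt.mul
      ((stepCutoff.contDiff (n := 2)).contDiffAt.comp x (contDiffAt_const.mul h1))
  · have : (fun x => χ x * stepCutoff (c * graphHeight T φ x)) =ᶠ[𝓝 x] fun _ => 0 := by
      filter_upwards [(isClosed_tsupport χ).isOpen_compl.mem_nhds hx] with z hz
      rw [image_eq_zero_of_notMem_tsupport hz, zero_mul]
    exact contDiffAt_const.congr_of_eventuallyEq this

/-- The cutoff vanishes from `-1` on rather than from `0` on, so even the closed support stays at
height at most `-1/c`, strictly below the graph. -/
theorem tsupport_cutoff_subset (h : IsLocalGraph Ω T B I φ)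
    (hχs : tsupport χ ⊆ T.symm ⁻¹' (B ×ˢ I)) {c : ℝ} (hc : 0 < c) :
    tsupport (fun x => χ x * stepCutoff (c * graphHeight T φ x)) ⊆ Ω := by
  have hcont : ContinuousOn (fun x => c * graphHeight T φ x) (tsupport χ) := fun x hx =>
    (continuousAt_const.mul
      (contDiffAt_graphHeight (T := T) (h.contDiffAt (hχs hx).1)).continuousAt).continuousWithinAt
  have hclosed : IsClosed (tsupport χ ∩ (fun x => c * graphHeight T φ x) ⁻¹' Iic (-1)) :=
    hcont.preimage_isClosed_of_isClosed (isClosed_tsupport χ) isClosed_Iic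
  have hsub : tsupport (fun x => χ x * stepCutoff (c * graphHeight T φ x)) ⊆
      tsupport χ ∩ (fun x => c * graphHeight T φ x) ⁻¹' Iic (-1) := by
    refine closure_minimal (fun x hx => ⟨?_, ?_⟩) hclosed
    · exact subset_tsupport χ (left_ne_zero_of_mul hx)
    · by_contra hcon
      rw [mem_preimage, mem_Iic, not_le] at hcon
      exact right_ne_zero_of_mul hx (stepCutoff.eq_zero hcon.le)
  intro x hx
  obtain ⟨h1, h2⟩ := hsub hx
  rw [h.mem_iff_graphHeight_neg (hχs h1)]
  rw [mem_preimage, mem_Iic] at h2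
  by_contra hcon
  have := mul_nonneg hc.le (not_lt.1 hcon)
  linarith

theorem fderiv_cutoff (h : IsLocalGraph Ω T B I φ) (hχ : ContDiff ℝ 2 χ)
    (hχs : tsupport χ ⊆ T.symm ⁻¹' (B ×ˢ I)) (c : ℝ) (x w : Euc d) :
    fderiv ℝ (fun x => χ x * stepCutoff (c * graphHeight T φ x)) x w =
      stepCutoff (c * graphHeight T φ x) * fderiv ℝ χ x w +
      c * deriv stepCutoff (c * graphHeight T φ x) * (χ x * graphCovector T φ x w) := by
  by_cases hx : x ∈ tsupport χ
  · have h1 : HasFDerivAt χ (fderiv ℝ χ x) x :=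
      (hχ.contDiffAt.differentiableAt (by norm_num)).hasFDerivAt
    have h2 := (hasFDerivAt_graphHeight (T := T) (h.contDiffAt (hχs hx).1)).const_mul c
    have h3 := (stepCutoff.hasDerivAt (c * graphHeight T φ x)).comp_hasFDerivAt x h2
    have h4 : HasFDerivAt (fun x => χ x * stepCutoff (c * graphHeight T φ x)) _ x := h1.mul h3
    rw [h4.fderiv]
    simp only [add_apply, smul_apply, smul_eq_mul]
    ring
  · have hz : χ =ᶠ[𝓝 x] fun _ => 0 := by
      filter_upwards [(isClosed_tsupport χ).isOpen_compl.mem_nhds hx] with z hz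
      exact image_eq_zero_of_notMem_tsupport hz
    have hz' : (fun x => χ x * stepCutoff (c * graphHeight T φ x)) =ᶠ[𝓝 x] fun _ => 0 := by
      filter_upwards [hz] with z hz
      rw [hz, zero_mul]
    rw [hz'.fderiv_eq, hz.fderiv_eq, hz.self_of_nhds]
    simp

theorem measurable_fluxDensity (hχ : ContDiff ℝ 2 χ) (hG : Measurable G) :
    Measurable fun x => χ x * graphCovector T φ x (G x) :=
  hχ.continuous.measurable.mul (measurable_graphCovector_apply hG)

theorem exists_bound_fluxDensity (h : IsLocalGraph Ω T B I φ) (hχ : ContDiff ℝ 2 χ)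
    (hχc : HasCompactSupport χ) (hχs : tsupport χ ⊆ T.symm ⁻¹' (B ×ˢ I)) {M : ℝ}
    (hM : ∀ x, ‖G x‖ ≤ M) : ∃ C, 0 ≤ C ∧ ∀ x, |χ x * graphCovector T φ x (G x)| ≤ C := by
  obtain ⟨C₁, hC₁⟩ := hχ.continuous.bounded_above_of_compact_support hχc
  obtain ⟨K, hK⟩ := h.lipschitz
  set N := ‖(T.symm : Euc d →L[ℝ] Euc m × ℝ)‖ with hN
  have hM0 : 0 ≤ M := (norm_nonneg _).trans (hM 0)
  have hC₁0 : 0 ≤ C₁ := (norm_nonneg _).trans (hC₁ 0)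
  refine ⟨C₁ * (N * M + K * (N * M)), by positivity, fun x => ?_⟩
  by_cases hx : x ∈ tsupport χ
  · have hTG : ‖T.symm (G x)‖ ≤ N * M :=
      ((T.symm : Euc d →L[ℝ] Euc m × ℝ).le_opNorm _).trans
        (mul_le_mul_of_nonneg_left (hM x) (norm_nonneg _))
    have h1 : ‖(T.symm (G x)).2‖ ≤ N * M := (norm_snd_le _).trans hTG
    have h2 : ‖(T.symm (G x)).1‖ ≤ N * M := (norm_fst_le _).trans hTG
    have h3 : ‖fderiv ℝ φ (T.symm x).1‖ ≤ K :=
      norm_fderiv_le_of_lipschitzOn ℝ (h.isOpen_base.mem_nhds (hχs hx).1) hK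
    have h4 : ‖fderiv ℝ φ (T.symm x).1 (T.symm (G x)).1‖ ≤ K * (N * M) :=
      (ContinuousLinearMap.le_opNorm _ _).trans
        (mul_le_mul h3 h2 (norm_nonneg _) K.2)
    rw [abs_mul, graphCovector_apply]
    refine mul_le_mul (hC₁ x) ?_ (abs_nonneg _) hC₁0
    exact (norm_sub_le _ _).trans (add_le_add h1 h4)
  · rw [image_eq_zero_of_notMem_tsupport hx, zero_mul, abs_zero]
    positivity

/-- The part of the flux that comes from the interior, in the limit of sharp cutoffs. -/
theorem tendsto_integral_cutoff_mul_fderiv (h : IsLocalGraph Ω T B I φ) (hΩ : IsOpen Ω)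
    (hχs : tsupport χ ⊆ T.symm ⁻¹' (B ×ˢ I)) (hint : Integrable fun x => fderiv ℝ χ x (G x)) :
    Tendsto (fun c : ℝ => ∫ x, stepCutoff (c * graphHeight T φ x) * fderiv ℝ χ x (G x)) atTop
      (𝓝 (∫ x in Ω, fderiv ℝ χ x (G x))) := by
  rw [← integral_indicator hΩ.measurableSet]
  have hmeas : ∀ c : ℝ, Measurable fun x => stepCutoff (c * graphHeight T φ x) := fun c =>
    (stepCutoff.contDiff (n := 0)).continuous.measurable.comp
      ((measurable_graphHeight h.measurable).const_mul c)
  refine tendsto_integral_filter_of_dominated_convergence (fun x => ‖fderiv ℝ χ x (G x)‖)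
    (Eventually.of_forall fun c => (hmeas c).aestronglyMeasurable.mul hint.aestronglyMeasurable)
    (Eventually.of_forall fun c => Eventually.of_forall fun x => ?_) hint.norm
    (Eventually.of_forall fun x => ?_)
  · rw [norm_mul]
    exact mul_le_of_le_one_left (norm_nonneg _) (stepCutoff.abs_le_one _)
  · by_cases hx : x ∈ tsupport χ
    · by_cases hxΩ : x ∈ Ω
      · rw [indicator_of_mem hxΩ]
        have hneg := (h.mem_iff_graphHeight_neg (hχs hx)).1 hxΩ
        have : Tendsto (fun c : ℝ => c * graphHeight T φ x) atTop atBot :=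
          tendsto_id.atTop_mul_const_of_neg hneg
        refine tendsto_const_nhds.congr' ?_
        filter_upwards [this.eventually (eventually_le_atBot (-2))] with c hc
        rw [stepCutoff.eq_one hc, one_mul]
      · rw [indicator_of_notMem hxΩ]
        have hnn := not_lt.1 (mt (h.mem_iff_graphHeight_neg (hχs hx)).2 hxΩ)
        refine tendsto_const_nhds.congr' ?_
        filter_upwards [eventually_ge_atTop 0] with c hc
        rw [stepCutoff.eq_zero (by linarith [mul_nonneg hc hnn]), zero_mul]
    · simp [fderiv_eq_zero_of_notMem_tsupport hx, indicator]

/-- Continuity up to the boundary of the flux through the translates of the graph. -/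
theorem tendsto_integral_fluxDensity (h : IsLocalGraph Ω T B I φ)
    (hχ : ContDiff ℝ 2 χ) (hχc : HasCompactSupport χ) (hχs : tsupport χ ⊆ T.symm ⁻¹' (B ×ˢ I))
    (hG : Measurable G) {M : ℝ} (hM : ∀ x, ‖G x‖ ≤ M) (hGc : ContinuousOn G (closure Ω)) :
    Tendsto (fun t : ℝ => ∫ y, χ (graphShear T φ (y, t)) *
        graphCovector T φ (graphShear T φ (y, t)) (G (graphShear T φ (y, t)))) (𝓝[<] 0)
      (𝓝 (∫ y, χ (graphShear T φ (y, 0)) *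
        graphCovector T φ (graphShear T φ (y, 0)) (G (graphShear T φ (y, 0))))) := by
  obtain ⟨C, hC0, hC⟩ := h.exists_bound_fluxDensity hχ hχc hχs hM
  set S : Set (Euc m) := (fun x => (T.symm x).1) '' tsupport χ with hS
  have hScomp : IsCompact S :=
    hχc.isCompact.image (continuous_fst.comp T.symm.continuous)
  have hoff : ∀ y ∉ S, ∀ t, χ (graphShear T φ (y, t)) = 0 := by
    intro y hy t
    refine image_eq_zero_of_notMem_tsupport fun hmem => hy ⟨_, hmem, ?_⟩
    simp [symm_graphShear]
  have hshear : ∀ t, Measurable fun y => graphShear T φ (y, t) := fun t =>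
    T.continuous.measurable.comp (measurable_id.prodMk (h.measurable.add_const t))
  refine tendsto_integral_filter_of_dominated_convergence (S.indicator fun _ => C)
    (Eventually.of_forall fun t =>
      ((measurable_fluxDensity hχ hG).comp (hshear t)).aestronglyMeasurable)
    (Eventually.of_forall fun t => Eventually.of_forall fun y => ?_)
    ((integrable_indicator_iff hScomp.measurableSet).2
      (integrableOn_const hScomp.measure_lt_top.ne))
    (Eventually.of_forall fun y => ?_)
  · by_cases hy : y ∈ S
    · rw [indicator_of_mem hy]; exact hC _
    · rw [indicator_of_notMem hy, hoff y hy t, zero_mul, norm_zero]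
  · have hline : Continuous fun t : ℝ => graphShear T φ (y, t) :=
      T.continuous.comp (continuous_const.prodMk (continuous_const_add (φ y)))
    have hlim : Tendsto (fun t : ℝ => graphShear T φ (y, t)) (𝓝[<] 0)
        (𝓝 (graphShear T φ (y, 0))) := (hline.tendsto 0).mono_left nhdsWithin_le_nhds
    by_cases hx : graphShear T φ (y, 0) ∈ tsupport χ
    · have hbox := hχs hx
      have hevΩ : ∀ᶠ t in 𝓝[<] (0 : ℝ), graphShear T φ (y, t) ∈ Ω := by
        filter_upwards [hlim.eventually (h.isOpen_box.mem_nhds hbox), self_mem_nhdsWithin]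
          with t ht ht0
        rw [h.mem_iff_graphHeight_neg ht, graphHeight_graphShear]
        exact ht0
      have hcl : graphShear T φ (y, 0) ∈ closure Ω := mem_closure_of_tendsto hlim hevΩ
      have hGlim : Tendsto (fun t : ℝ => G (graphShear T φ (y, t))) (𝓝[<] 0)
          (𝓝 (G (graphShear T φ (y, 0)))) :=
        (hGc _ hcl).tendsto.comp (tendsto_nhdsWithin_iff.2
          ⟨hlim, hevΩ.mono fun t ht => subset_closure ht⟩)
      refine ((hχ.continuous.tendsto _).comp hlim).mul ?_
      -- The covector depends only on the base point, so it is constant along vertical lines and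
      -- continuity of `G` suffices.
      have hcov : ∀ t, graphCovector T φ (graphShear T φ (y, t)) =
          graphCovector T φ (graphShear T φ (y, 0)) := fun t => by
        simp only [graphCovector, symm_graphShear]
      simp only [hcov]
      exact ((graphCovector T φ (graphShear T φ (y, 0))).continuous.tendsto _).comp hGlim
    · have hev : ∀ᶠ t in 𝓝[<] (0 : ℝ), graphShear T φ (y, t) ∉ tsupport χ :=
        hlim.eventually ((isClosed_tsupport χ).isOpen_compl.mem_nhds hx)
      rw [image_eq_zero_of_notMem_tsupport hx, zero_mul]
      refine tendsto_const_nhds.congr' ?_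
      filter_upwards [hev] with t ht
      rw [image_eq_zero_of_notMem_tsupport ht, zero_mul]

end IsLocalGraph

/-! ### The divergence theorem in a chart -/

namespace IsLocalGraph

variable {d m : ℕ} {Ω : Set (Euc d)} {T : (Euc m × ℝ) ≃L[ℝ] Euc d} {B : Set (Euc m)} {I : Set ℝ}
    {φ : Euc m → ℝ} {χ : Euc d → ℝ} {G : Euc d → Euc d}

/-- The part of the flux that comes from the boundary layer, in the limit of sharp cutoffs. -/
theorem tendsto_integral_deriv_cutoff (h : IsLocalGraph Ω T B I φ) (hT : IsOrthogonalSplitting T)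
    (hχ : ContDiff ℝ 2 χ) (hχc : HasCompactSupport χ) (hχs : tsupport χ ⊆ T.symm ⁻¹' (B ×ˢ I))
    (hG : Measurable G) {M : ℝ} (hM : ∀ x, ‖G x‖ ≤ M) (hGc : ContinuousOn G (closure Ω)) :
    Tendsto (fun c : ℝ => ∫ x, c * deriv stepCutoff (c * graphHeight T φ x) *
        (χ x * graphCovector T φ x (G x))) atTop
      (𝓝 (-∫ y, χ (graphShear T φ (y, 0)) *
        graphCovector T φ (graphShear T φ (y, 0)) (G (graphShear T φ (y, 0))))) := by
  obtain ⟨C, hC0, hC⟩ := h.exists_bound_fluxDensity hχ hχc hχs hM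
  obtain ⟨D, hD⟩ := stepCutoff.continuous_deriv.bounded_above_of_compact_support
    stepCutoff.hasCompactSupport_deriv
  have hKm := measurable_fluxDensity (T := T) (φ := φ) hχ hG
  set K : Euc d → ℝ := fun x => χ x * graphCovector T φ x (G x) with hK
  have hK0 : ∀ x ∉ tsupport χ, K x = 0 := fun x hx => by
    rw [hK]; simp only [image_eq_zero_of_notMem_tsupport hx, zero_mul]
  have hΘ := hT.measurePreserving_graphShear h.measurable
  -- `w t` is the flux of `χ G` through the graph translated by `t`.
  set w : ℝ → ℝ := fun t => ∫ y, K (graphShear T φ (y, t)) with hw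
  have hwlim : Tendsto w (𝓝[<] 0) (𝓝 (w 0)) :=
    h.tendsto_integral_fluxDensity hχ hχc hχs hG hM hGc
  have hwm : StronglyMeasurable w :=
    (hKm.comp hΘ.measurable).stronglyMeasurable.integral_prod_left'
  have hwb : ∃ A, ∀ t, |w t| ≤ A := by
    set S : Set (Euc m) := (fun x => (T.symm x).1) '' tsupport χ with hS
    have hScomp : IsCompact S := hχc.isCompact.image (continuous_fst.comp T.symm.continuous)
    have hoff : ∀ t, ∀ y ∉ S, K (graphShear T φ (y, t)) = 0 := by
      intro t y hy
      refine hK0 _ fun hmem => hy ⟨_, hmem, ?_⟩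
      simp [symm_graphShear]
    refine ⟨C * volume.real S, fun t => ?_⟩
    change |∫ y, K (graphShear T φ (y, t))| ≤ _
    rw [← setIntegral_eq_integral_of_forall_compl_eq_zero (hoff t), ← Real.norm_eq_abs]
    exact norm_setIntegral_le_of_norm_le_const hScomp.measure_lt_top
      fun y _ => hC (graphShear T φ (y, t))
  obtain ⟨A, hA⟩ := hwb
  -- Fubini in the sheared coordinates, followed by the rescaling of the height by `c`, absorbs the
  -- factor `c` and moves it into the argument of `w`.
  have hrewrite : ∀ c : ℝ, 0 < c →
      ∫ x, c * deriv stepCutoff (c * graphHeight T φ x) * K x =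
        ∫ t, deriv stepCutoff t * w (c⁻¹ * t) := by
    intro c hc
    have hmeas : Measurable fun x => c * deriv stepCutoff (c * graphHeight T φ x) * K x :=
      ((stepCutoff.continuous_deriv.measurable.comp
        ((measurable_graphHeight h.measurable).const_mul c)).const_mul c).mul hKm
    have hint : Integrable fun x => c * deriv stepCutoff (c * graphHeight T φ x) * K x := by
      refine integrable_of_bounded_of_isCompact hmeas.aestronglyMeasurable (C := c * D * C)
        (fun x => ?_) hχc.isCompact fun x hx => by rw [hK0 x hx, mul_zero]
      rw [abs_mul, abs_mul, abs_of_pos hc]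
      have hD' := hD (c * graphHeight T φ x)
      rw [Real.norm_eq_abs] at hD'
      exact mul_le_mul (mul_le_mul_of_nonneg_left hD' hc.le) (hC x) (abs_nonneg _)
        (mul_nonneg hc.le ((abs_nonneg _).trans hD'))
    have hint' : Integrable (fun p => c * deriv stepCutoff (c * graphHeight T φ (graphShear T φ p)) *
        K (graphShear T φ p)) (volume.prod volume) :=
      (hΘ.integrable_comp hint.aestronglyMeasurable).2 hint
    rw [← hΘ.map_eq, integral_map hΘ.measurable.aemeasurable hmeas.aestronglyMeasurable,
      integral_prod_symm _ hint']
    simp only [graphHeight_graphShear, integral_const_mul]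
    have hscale := Measure.integral_comp_mul_left
      (fun t => deriv stepCutoff t * w (c⁻¹ * t)) c
    simp only [inv_mul_cancel_left₀ hc.ne', smul_eq_mul] at hscale
    rw [abs_of_pos (inv_pos.2 hc)] at hscale
    have h2 : ∫ t, deriv stepCutoff t * w (c⁻¹ * t) =
        c * ∫ t, deriv stepCutoff (c * t) * w t := by
      rw [hscale, mul_inv_cancel_left₀ hc.ne']
    rw [h2, ← integral_const_mul]
    refine integral_congr_ae (Eventually.of_forall fun t => ?_)
    simp only [hw, mul_assoc]
  have hlim : Tendsto (fun c : ℝ => ∫ t, deriv stepCutoff t * w (c⁻¹ * t)) atTop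
      (𝓝 (∫ t, deriv stepCutoff t * w 0)) := by
    refine tendsto_integral_filter_of_dominated_convergence (fun t => |deriv stepCutoff t| * A)
      (Eventually.of_forall fun c =>
        (stepCutoff.continuous_deriv.measurable.mul
          (hwm.measurable.comp (measurable_const_mul c⁻¹))).aestronglyMeasurable)
      (Eventually.of_forall fun c => Eventually.of_forall fun t => ?_)
      (stepCutoff.integrable_deriv.abs.mul_const A)
      (Eventually.of_forall fun t => ?_)
    · rw [norm_mul, Real.norm_eq_abs, Real.norm_eq_abs]
      exact mul_le_mul_of_nonneg_left (hA _) (abs_nonneg _)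
    -- On the support of the derivative `t` is negative, so `c⁻¹ * t` tends to `0` from the side of
    -- `Ω`, the only side on which `w` is known to converge.
    · by_cases ht : t ∈ Icc (-2 : ℝ) (-1)
      · refine tendsto_const_nhds.mul (hwlim.comp (tendsto_nhdsWithin_iff.2 ⟨?_, ?_⟩))
        · simpa using tendsto_inv_atTop_zero.mul_const t
        · filter_upwards [eventually_gt_atTop 0] with c hc
          exact mul_neg_of_pos_of_neg (inv_pos.2 hc) (by linarith [ht.2])
      · simp only [stepCutoff.deriv_eq_zero ht, zero_mul]
        exact tendsto_const_nhds
  rw [integral_mul_const, stepCutoff.integral_deriv, neg_one_mul] at hlim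
  refine hlim.congr' ?_
  filter_upwards [eventually_gt_atTop 0] with c hc
  exact (hrewrite c hc).symm

/-- The divergence theorem in a graph chart, for a field which is continuous up to the boundary
and weakly divergence free. -/
theorem integral_flux (h : IsLocalGraph Ω T B I φ) (hT : IsOrthogonalSplitting T)
    (hΩ : IsSmoothBoundedDomain Ω) (hd : d = m + 1)
    (hG : Measurable G) {M : ℝ} (hM : ∀ x, ‖G x‖ ≤ M) (hGc : ContinuousOn G (closure Ω))
    (hdiv : ∀ ψ : Euc d → ℝ, ContDiff ℝ 2 ψ → HasCompactSupport ψ → tsupport ψ ⊆ Ω →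
      ∫ x, fderiv ℝ ψ x (G x) = 0)
    (hχ : ContDiff ℝ 2 χ) (hχc : HasCompactSupport χ) (hχs : tsupport χ ⊆ T.symm ⁻¹' (B ×ˢ I)) :
    Integrable (fun x => χ x * inner ℝ (outerNormal Ω x) (G x)) (surfaceMeasure Ω) ∧
    ∫ x, χ x * inner ℝ (outerNormal Ω x) (G x) ∂(surfaceMeasure Ω) =
      ∫ x in Ω, fderiv ℝ χ x (G x) := by
  obtain ⟨C, hC0, hC⟩ := h.exists_bound_fluxDensity hχ hχc hχs hM
  have hKm := measurable_fluxDensity (T := T) (φ := φ) hχ hG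
  have hK0 : ∀ x ∉ tsupport χ, χ x * graphCovector T φ x (G x) = 0 := fun x hx => by
    rw [image_eq_zero_of_notMem_tsupport hx, zero_mul]
  have hinta := integrable_fderiv_apply hχ hχc hG hM
  -- Compare the two contributions to the vanishing integral of the cut off test function.
  have hsum : ∀ c : ℝ, 0 < c →
      ∫ x, stepCutoff (c * graphHeight T φ x) * fderiv ℝ χ x (G x) =
        -∫ x, c * deriv stepCutoff (c * graphHeight T φ x) *
          (χ x * graphCovector T φ x (G x)) := by
    intro c hc
    obtain ⟨D, hD⟩ := stepCutoff.continuous_deriv.bounded_above_of_compact_support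
      stepCutoff.hasCompactSupport_deriv
    have hθ := (measurable_graphHeight (T := T) h.measurable).const_mul c
    have hint1 : Integrable fun x => stepCutoff (c * graphHeight T φ x) * fderiv ℝ χ x (G x) := by
      refine hinta.mono (((stepCutoff.contDiff (n := 0)).continuous.measurable.comp
        hθ).aestronglyMeasurable.mul hinta.aestronglyMeasurable) (Eventually.of_forall fun x => ?_)
      rw [norm_mul]
      exact mul_le_of_le_one_left (norm_nonneg _) (stepCutoff.abs_le_one _)
    have hint2 : Integrable fun x => c * deriv stepCutoff (c * graphHeight T φ x) *
        (χ x * graphCovector T φ x (G x)) := by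
      refine integrable_of_bounded_of_isCompact (C := c * D * C)
        (((stepCutoff.continuous_deriv.measurable.comp hθ).const_mul c).mul
          hKm).aestronglyMeasurable
        (fun x => ?_) hχc.isCompact fun x hx => by rw [hK0 x hx, mul_zero]
      rw [abs_mul, abs_mul c, abs_of_pos hc]
      have hD' := hD (c * graphHeight T φ x)
      rw [Real.norm_eq_abs] at hD'
      exact mul_le_mul (mul_le_mul_of_nonneg_left hD' hc.le) (hC x) (abs_nonneg _)
        (mul_nonneg hc.le ((abs_nonneg _).trans hD'))
    have hzero := hdiv _ (h.contDiff_cutoff hχ hχs c) (hχc.mul_right)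
      (h.tsupport_cutoff_subset hχs hc)
    simp only [h.fderiv_cutoff hχ hχs c] at hzero
    rw [integral_add hint1 hint2] at hzero
    linarith
  have hlim1 := h.tendsto_integral_cutoff_mul_fderiv hΩ.isOpen hχs hinta
  have hlim2 := (h.tendsto_integral_deriv_cutoff hT hχ hχc hχs hG hM hGc).neg
  rw [neg_neg] at hlim2
  have hflux : ∫ x in Ω, fderiv ℝ χ x (G x) = ∫ y, χ (graphShear T φ (y, 0)) *
      graphCovector T φ (graphShear T φ (y, 0)) (G (graphShear T φ (y, 0))) := by
    refine tendsto_nhds_unique (hlim1.congr' ?_) hlim2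
    filter_upwards [eventually_gt_atTop 0] with c hc
    exact hsum c hc
  have hshear : ∀ y, graphShear T φ (y, 0) = T (y, φ y) := fun y => by simp [graphShear]
  simp only [hshear] at hflux
  have hΨm : Measurable fun y => T (y, φ y) :=
    T.continuous.measurable.comp (measurable_id.prodMk h.measurable)
  -- The area factor cancels the normalisation of the outer normal.
  have hpt : ∀ y ∈ B, √(1 + ‖gradient φ y‖ ^ 2) * (χ (T (y, φ y)) *
      inner ℝ (outerNormal Ω (T (y, φ y))) (G (T (y, φ y)))) =
      χ (T (y, φ y)) * graphCovector T φ (T (y, φ y)) (G (T (y, φ y))) := by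
    intro y hy
    have hpos : 0 < √(1 + ‖gradient φ y‖ ^ 2) := by positivity
    have hcov : inner ℝ (T (-gradient φ y, 1)) (G (T (y, φ y))) =
        graphCovector T φ (T (y, φ y)) (G (T (y, φ y))) := by
      conv_lhs => rw [← T.apply_symm_apply (G (T (y, φ y)))]
      rw [hT, graphCovector_apply, T.symm_apply_apply, fderiv_eq_inner_gradient, inner_neg_left]
      ring
    rw [h.outerNormal_eq hT hΩ hy, real_inner_smul_left, hcov]
    field_simp
  have hoffB : ∀ y ∉ B, χ (T (y, φ y)) * graphCovector T φ (T (y, φ y)) (G (T (y, φ y))) = 0 := by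
    intro y hy
    refine hK0 _ fun hmem => hy ?_
    have := (hχs hmem).1
    rwa [T.symm_apply_apply] at this
  have hfm : AEStronglyMeasurable (fun y => χ (T (y, φ y)) *
      inner ℝ (outerNormal Ω (T (y, φ y))) (G (T (y, φ y)))) (volume.restrict B) := by
    have hJ : AEStronglyMeasurable (fun y => (√(1 + ‖gradient φ y‖ ^ 2))⁻¹)
        (volume.restrict B) :=
      ((h.continuousOn_areaFactor.inv₀ fun y _ => by positivity).aestronglyMeasurable
        h.isOpen_base.measurableSet)
    refine (hJ.mul (hKm.comp hΨm).aestronglyMeasurable).congr ?_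
    filter_upwards [ae_restrict_mem h.isOpen_base.measurableSet] with y hy
    have hpos : 0 < √(1 + ‖gradient φ y‖ ^ 2) := by positivity
    simp only [Pi.mul_apply, Function.comp_apply]
    rw [← hpt y hy, inv_mul_cancel_left₀ hpos.ne']
  obtain ⟨hsurf, hsint⟩ := h.surfaceMeasure_integral hT hΩ.isOpen hd
    (f := fun x => χ x * inner ℝ (outerNormal Ω x) (G x))
    (fun x hx => by
      rw [image_eq_zero_of_notMem_tsupport fun hmem => hx (hχs hmem), zero_mul]) hfm
  constructor
  · refine hsint ?_
    rw [integrableOn_congr_fun hpt h.isOpen_base.measurableSet]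
    refine (integrable_of_bounded_of_isCompact (hKm.comp hΨm).aestronglyMeasurable
      (fun y => hC _) (hχc.isCompact.image (continuous_fst.comp T.symm.continuous))
      fun y hy => hK0 _ fun hmem => hy ⟨_, hmem, ?_⟩).integrableOn
    simp
  · rw [hsurf, setIntegral_congr_fun h.isOpen_base.measurableSet hpt,
      setIntegral_eq_integral_of_forall_compl_eq_zero hoffB, hflux]

end IsLocalGraph

/-! ### The global divergence theorem -/

/-- A finite smooth partition of unity on a compact set, subordinate to a family of
neighbourhoods and made of compactly supported functions. -/
theorem IsCompact.exists_finite_partitionOfUnity {E : Type*} [NormedAddCommGroup E]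
    [NormedSpace ℝ E] [FiniteDimensional ℝ E] {S : Set E} (hS : IsCompact S) {U : E → Set E}
    (hU : ∀ x ∈ S, IsOpen (U x) ∧ x ∈ U x) :
    ∃ (t : Finset S) (χ : t → E → ℝ), (∀ k, ContDiff ℝ ∞ (χ k)) ∧ (∀ k, HasCompactSupport (χ k)) ∧
      (∀ k : t, tsupport (χ k) ⊆ U k) ∧ ∀ x ∈ S, ∑ k, χ k x = 1 := by
  -- Intersecting with unit balls forces the partition functions to have compact support.
  obtain ⟨t, ht⟩ := hS.elim_finite_subcover (fun x : S => U x ∩ ball (x : E) 1)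
    (fun x => (hU x x.2).1.inter isOpen_ball)
    fun x hx => mem_iUnion.2 ⟨⟨x, hx⟩, (hU x hx).2, mem_ball_self one_pos⟩
  obtain ⟨f, hf⟩ := SmoothPartitionOfUnity.exists_isSubordinate 𝓘(ℝ, E) hS.isClosed
    (fun k : t => U k ∩ ball (k : E) 1) (fun k => (hU _ k.1.2).1.inter isOpen_ball) (by
      intro x hx
      obtain ⟨k, hk, hxk⟩ := mem_iUnion₂.1 (ht hx)
      exact mem_iUnion.2 ⟨⟨k, hk⟩, hxk⟩)
  refine ⟨t, fun k => f k, fun k => (f k).contMDiff.contDiff, fun k => ?_, fun k => ?_, ?_⟩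
  · exact isCompact_of_isClosed_isBounded (isClosed_tsupport _)
      (isBounded_ball.subset ((hf k).trans inter_subset_right))
  · exact (hf k).trans inter_subset_left
  · intro x hx
    rw [← finsum_eq_sum_of_fintype]
    exact f.sum_eq_one hx

/-- The divergence theorem for a field which is continuous up to the boundary and weakly divergence
free. -/
theorem IsSmoothBoundedDomain.integral_flux_eq_zero {d m : ℕ} {Ω : Set (Euc d)}
    (hΩ : IsSmoothBoundedDomain Ω) (hd : d = m + 1) {G : Euc d → Euc d}
    (hGc : ContinuousOn G (closure Ω))
    (hdiv : ∀ ψ : Euc d → ℝ, ContDiff ℝ 2 ψ → HasCompactSupport ψ → tsupport ψ ⊆ Ω →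
      ∫ x, fderiv ℝ ψ x (G x) = 0) :
    ∫ x, inner ℝ (outerNormal Ω x) (G x) ∂(surfaceMeasure Ω) = 0 := by
  have hcomp : IsCompact (closure Ω) := hΩ.isBounded.isCompact_closure
  -- Extension by zero gives a bounded measurable field on the whole space; neither the test
  -- functions supported in `Ω` nor the boundary integral notice the change.
  set G' := (closure Ω).indicator G with hG'
  have hGG' : EqOn G' G (closure Ω) := fun x hx => indicator_of_mem hx G
  have hG'c : ContinuousOn G' (closure Ω) := hGc.congr hGG'
  have hG'm : Measurable G' := hGc.measurable_indicator isClosed_closure.measurableSet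
  obtain ⟨M, hM⟩ := hcomp.exists_bound_of_continuousOn hGc
  have hM' : ∀ x, ‖G' x‖ ≤ max M 0 := by
    intro x
    by_cases hx : x ∈ closure Ω
    · rw [hGG' hx]; exact (hM x hx).trans (le_max_left _ _)
    · rw [hG', indicator_of_notMem hx, norm_zero]; exact le_max_right _ _
  have hdiv' : ∀ ψ : Euc d → ℝ, ContDiff ℝ 2 ψ → HasCompactSupport ψ → tsupport ψ ⊆ Ω →
      ∫ x, fderiv ℝ ψ x (G' x) = 0 := by
    intro ψ h1 h2 h3
    rw [← hdiv ψ h1 h2 h3]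
    refine integral_congr_ae (Eventually.of_forall fun x => ?_)
    by_cases hx : x ∈ tsupport ψ
    · simp only [hGG' (subset_closure (h3 hx))]
    · simp only [fderiv_eq_zero_of_notMem_tsupport hx, zero_apply]
  -- At interior points `U = Ω` works, both sides being zero; at boundary points `U` is the box of a
  -- graph chart.
  have hlocal : ∀ x ∈ closure Ω, ∃ U : Set (Euc d), (IsOpen U ∧ x ∈ U) ∧
      ∀ χ : Euc d → ℝ, ContDiff ℝ 2 χ → HasCompactSupport χ → tsupport χ ⊆ U →
        Integrable (fun x => χ x * inner ℝ (outerNormal Ω x) (G' x)) (surfaceMeasure Ω) ∧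
        ∫ x, χ x * inner ℝ (outerNormal Ω x) (G' x) ∂(surfaceMeasure Ω) =
          ∫ x in Ω, fderiv ℝ χ x (G' x) := by
    intro x hx
    by_cases hxΩ : x ∈ Ω
    · refine ⟨Ω, ⟨hΩ.isOpen, hxΩ⟩, fun χ hχ hχc hχs => ?_⟩
      have hzero : (fun x => χ x * inner ℝ (outerNormal Ω x) (G' x)) =ᵐ[surfaceMeasure Ω] 0 := by
        filter_upwards [ae_restrict_mem isClosed_frontier.measurableSet] with z hz
        rw [hΩ.isOpen.frontier_eq] at hz
        rw [image_eq_zero_of_notMem_tsupport fun hmem => hz.2 (hχs hmem), zero_mul]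
        rfl
      refine ⟨(integrable_zero _ _ _).congr hzero.symm, ?_⟩
      rw [integral_congr_ae hzero, setIntegral_eq_integral_of_forall_compl_eq_zero,
        hdiv' χ hχ hχc hχs]
      · simp
      · intro z hz
        rw [fderiv_eq_zero_of_notMem_tsupport fun hmem => hz (hχs hmem)]
        rfl
    · have hxf : x ∈ frontier Ω := by rw [hΩ.isOpen.frontier_eq]; exact ⟨hx, hxΩ⟩
      obtain ⟨T, B, I, φ, hT, h, hbox⟩ := hΩ.exists_isLocalGraph hd hxf
      exact ⟨_, ⟨h.isOpen_box, hbox⟩, fun χ hχ hχc hχs =>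
        h.integral_flux hT hΩ hd hG'm hM' hG'c hdiv' hχ hχc hχs⟩
  choose! U hU hflux using hlocal
  obtain ⟨t, χ, hχ, hχc, hχs, hsum⟩ := hcomp.exists_finite_partitionOfUnity hU
  have hχ2 : ∀ k, ContDiff ℝ 2 (χ k) := fun k =>
    (hχ k).of_le (WithTop.coe_le_coe.2 (le_top : (2 : ℕ∞) ≤ ⊤))
  have hk := fun k : t => hflux k k.1.2 (χ k) (hχ2 k) (hχc k) (hχs k)
  have h1 : ∫ x, inner ℝ (outerNormal Ω x) (G x) ∂(surfaceMeasure Ω) =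
      ∫ x, ∑ k, χ k x * inner ℝ (outerNormal Ω x) (G' x) ∂(surfaceMeasure Ω) := by
    refine setIntegral_congr_fun isClosed_frontier.measurableSet fun x hx => ?_
    have hxc := frontier_subset_closure hx
    simp only [← Finset.sum_mul, hsum x hxc, one_mul, hGG' hxc]
  rw [h1, integral_finsetSum _ fun k _ => (hk k).1, Finset.sum_congr rfl fun k _ => (hk k).2,
    ← integral_finsetSum _ fun k _ =>
      (integrable_fderiv_apply (hχ2 k) (hχc k) hG'm hM').integrableOn]
  -- The partition functions sum to `1` throughout `Ω`, so their derivatives sum to `0` there.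
  refine setIntegral_eq_zero_of_forall_eq_zero fun x hx => ?_
  have hderiv : HasFDerivAt (fun z => ∑ k, χ k z) (∑ k, fderiv ℝ (χ k) x) x :=
    HasFDerivAt.fun_sum fun k _ => ((hχ2 k).contDiffAt.differentiableAt (by norm_num)).hasFDerivAt
  have hconst : (fun z => ∑ k, χ k z) =ᶠ[𝓝 x] fun _ => 1 := by
    filter_upwards [hΩ.isOpen.mem_nhds hx] with z hz
    exact hsum z (subset_closure hz)
  have hzero := hderiv.unique ((hasFDerivAt_const (1 : ℝ) x).congr_of_eventuallyEq hconst)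
  rw [← sum_apply, hzero, zero_apply]

/-! ### Rotated gradients -/

section WeakDivergence

variable {E : Type*} [NormedAddCommGroup E] [NormedSpace ℝ E] [FiniteDimensional ℝ E]
  [MeasurableSpace E] [BorelSpace E] {μ : Measure E} [μ.IsAddHaarMeasure]

theorem integral_fderiv_apply_eq_zero {f : E → ℝ} (hf : ContDiff ℝ 1 f) (hc : HasCompactSupport f)
    (v : E) : ∫ x, fderiv ℝ f x v ∂μ = 0 := by
  have hint : Integrable (fun x => fderiv ℝ f x v) μ :=
    ((hf.continuous_fderiv one_ne_zero).clm_apply continuous_const).integrable_of_hasCompactSupport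
      (hc.fderiv_apply ℝ v)
  have hint' : Integrable f μ := hf.continuous.integrable_of_hasCompactSupport hc
  have := integral_mul_fderiv_eq_neg_fderiv_mul_of_integrable (μ := μ) (f := fun _ : E => (1 : ℝ))
    (g := f) (v := v) (by simp) (by simpa using hint) (by simpa using hint')
    (fun x _ => differentiableAt_const _) (fun x _ => hf.differentiable one_ne_zero x)
  simpa using this

/-- Rotated gradients are weakly divergence free. -/
theorem integral_fderiv_mul_fderiv_sub_eq_zero {Ω : Set E} (hΩ : IsOpen Ω) {q ψ : E → ℝ}
    (hq : ContDiffOn ℝ 1 q Ω) (hψ : ContDiff ℝ 2 ψ) (hψc : HasCompactSupport ψ)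
    (hψs : tsupport ψ ⊆ Ω) (a b : E) :
    ∫ x, (fderiv ℝ q x b * fderiv ℝ ψ x a - fderiv ℝ q x a * fderiv ℝ ψ x b) ∂μ = 0 := by
  have hψ' : ContDiff ℝ 1 (fderiv ℝ ψ) := hψ.fderiv_right (by norm_num)
  have hoff : ∀ x ∉ tsupport ψ, ∀ v, (fun z => q z * fderiv ℝ ψ z v) =ᶠ[𝓝 x] fun _ => 0 := by
    intro x hx v
    filter_upwards [(isClosed_tsupport ψ).isOpen_compl.mem_nhds hx] with z hz
    rw [fderiv_eq_zero_of_notMem_tsupport hz, zero_apply, mul_zero]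
  have hC : ∀ v, ContDiff ℝ 1 fun z => q z * fderiv ℝ ψ z v := by
    intro v
    rw [contDiff_iff_contDiffAt]
    intro x
    by_cases hx : x ∈ tsupport ψ
    · exact (hq.contDiffAt (hΩ.mem_nhds (hψs hx))).mul (hψ'.clm_apply contDiff_const).contDiffAt
    · exact contDiffAt_const.congr_of_eventuallyEq (hoff x hx v)
  have hcs : ∀ v, HasCompactSupport fun z => q z * fderiv ℝ ψ z v := fun v =>
    (hψc.fderiv_apply ℝ v).mul_left
  have hint : ∀ v w, Integrable (fun x => fderiv ℝ (fun z => q z * fderiv ℝ ψ z v) x w) μ :=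
    fun v w => (((hC v).continuous_fderiv one_ne_zero).clm_apply
      continuous_const).integrable_of_hasCompactSupport ((hcs v).fderiv_apply ℝ w)
  -- As `q` is only `C¹`, the second derivatives are put on `ψ`; their symmetry cancels the terms `q
  -- D²ψ`, leaving derivatives of compactly supported functions.
  have hpt : ∀ x, fderiv ℝ q x b * fderiv ℝ ψ x a - fderiv ℝ q x a * fderiv ℝ ψ x b =
      fderiv ℝ (fun z => q z * fderiv ℝ ψ z a) x b -
        fderiv ℝ (fun z => q z * fderiv ℝ ψ z b) x a := by
    intro x
    by_cases hx : x ∈ tsupport ψ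
    · have hqx : HasFDerivAt q (fderiv ℝ q x) x :=
        ((hq.contDiffAt (hΩ.mem_nhds (hψs hx))).differentiableAt one_ne_zero).hasFDerivAt
      have hψx : HasFDerivAt (fderiv ℝ ψ) (fderiv ℝ (fderiv ℝ ψ) x) x :=
        (hψ'.differentiable one_ne_zero x).hasFDerivAt
      have hv : ∀ v w, fderiv ℝ (fun z => q z * fderiv ℝ ψ z v) x w =
          q x * fderiv ℝ (fderiv ℝ ψ) x w v + fderiv ℝ ψ x v * fderiv ℝ q x w := by
        intro v w
        have h1 : HasFDerivAt (fun z => fderiv ℝ ψ z v)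
            ((ContinuousLinearMap.apply ℝ ℝ v) ∘L fderiv ℝ (fderiv ℝ ψ) x) x :=
          (ContinuousLinearMap.apply ℝ ℝ v).hasFDerivAt.comp x hψx
        have h2 : HasFDerivAt (fun z => q z * fderiv ℝ ψ z v) _ x := hqx.mul h1
        rw [h2.fderiv]
        simp
      have hsymm : fderiv ℝ (fderiv ℝ ψ) x a b = fderiv ℝ (fderiv ℝ ψ) x b a :=
        (hψ.contDiffAt (x := x)).isSymmSndFDerivAt (by simp) a b
      rw [hv, hv, hsymm]
      ring
    · rw [(hoff x hx a).fderiv_eq, (hoff x hx b).fderiv_eq, fderiv_eq_zero_of_notMem_tsupport hx]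
      simp
  simp only [hpt]
  rw [integral_sub (hint a b) (hint b a), integral_fderiv_apply_eq_zero (hC a) (hcs a),
    integral_fderiv_apply_eq_zero (hC b) (hcs b), sub_zero]

end WeakDivergence

/-! ### Tangential derivatives on the boundary -/

section TangentialIntegral

variable {d m : ℕ} {Ω : Set (Euc d)}

theorem inner_stdVec (x : Euc d) (i : Fin d) : inner ℝ x (stdVec i) = x i := by
  simp [stdVec, EuclideanSpace.inner_single_right]

/-- If a field of covectors which is continuous up to the boundary is exact in `Ω`, then its
tangential components have vanishing integral over `∂Ω`. -/
theorem IsSmoothBoundedDomain.integral_tangential_eq_zero (hΩ : IsSmoothBoundedDomain Ω)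
    (hd : d = m + 1) {D : Euc d → Euc d →L[ℝ] ℝ} (hD : ContinuousOn D (closure Ω))
    {q : Euc d → ℝ} (hq : ContDiffOn ℝ 1 q Ω) (hDq : ∀ x ∈ Ω, D x = fderiv ℝ q x) (i j : Fin d) :
    ∫ x, D x (outerNormal Ω x i • stdVec j - outerNormal Ω x j • stdVec i)
      ∂(surfaceMeasure Ω) = 0 := by
  -- The normal component of this field is `D` applied to `nᵢ eⱼ - nⱼ eᵢ`.
  have hflux := hΩ.integral_flux_eq_zero hd
    (G := fun x => D x (stdVec j) • stdVec i - D x (stdVec i) • stdVec j)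
    (((hD.clm_apply continuousOn_const).smul continuousOn_const).sub
      ((hD.clm_apply continuousOn_const).smul continuousOn_const)) ?_
  · rw [← hflux]
    refine integral_congr_ae (Eventually.of_forall fun x => ?_)
    simp only [map_sub, map_smul, smul_eq_mul, inner_sub_right, real_inner_smul_right,
      inner_stdVec]
    ring
  · intro ψ hψ hψc hψs
    rw [← integral_fderiv_mul_fderiv_sub_eq_zero (μ := volume) hΩ.isOpen hq hψ hψc hψs
      (stdVec i) (stdVec j)]
    refine integral_congr_ae (Eventually.of_forall fun x => ?_)
    by_cases hx : x ∈ tsupport ψ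
    · simp only [hDq x (hψs hx), map_sub, map_smul, smul_eq_mul]
    · simp only [fderiv_eq_zero_of_notMem_tsupport hx, zero_apply, mul_zero, sub_zero]

/-- Tangential derivatives of boundary values, in terms of an extension which is differentiable up
to the boundary. -/
theorem IsSmoothBoundedDomain.tangentialDeriv_eq (hΩ : IsSmoothBoundedDomain Ω)
    (hd : d = m + 1) {f k : Euc d → ℝ} (hf : ContDiffOn ℝ ∞ f (frontier Ω))
    (hk : ContDiffOn ℝ 1 k (closure Ω)) (hfk : ∀ x ∈ frontier Ω, k x = f x) (i j : Fin d)
    {x : Euc d} (hx : x ∈ frontier Ω) :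
    tangentialDeriv Ω i j f x = fderivWithin ℝ k (closure Ω) x
      (outerNormal Ω x i • stdVec j - outerNormal Ω x j • stdVec i) := by
  obtain ⟨T, B, I, φ, hT, h, hbox⟩ := hΩ.exists_isLocalGraph hd hx
  obtain ⟨y, hy, rfl⟩ := (h.frontier_inter_box hΩ.isOpen).subset ⟨hx, hbox⟩
  refine h.fderivWithin_frontier_eq hT hΩ hy (hf.differentiableOn (by simp) _ hx)
    (hk.differentiableOn one_ne_zero _ (frontier_subset_closure hx)).hasFDerivWithinAt hfk ?_
  simp only [inner_sub_right, real_inner_smul_right, inner_stdVec]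
  ring

end TangentialIntegral

/-! ### Solutions at rest and the main theorem -/

theorem fderivWithin_closure_of_mem {d : ℕ} {Ω : Set (Euc d)} (hΩ : IsOpen Ω) {x : Euc d}
    (hx : x ∈ Ω) (f : Euc d → ℝ) : fderivWithin ℝ f (closure Ω) x = fderiv ℝ f x :=
  fderivWithin_of_mem_nhds (mem_of_superset (hΩ.mem_nhds hx) subset_closure)

/-- In a solution at rest the electric force is balanced by a pressure. -/
theorem IsSteadyNPNS.exists_pressure_of_velocity_eq_zero {d : ℕ} {Ω : Set (Euc d)}
    {γ₁ γ₂ W c₁ c₂ Φ : Euc d → ℝ} {u : Euc d → Euc d} (hΩ : IsOpen Ω)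
    (hsol : IsSteadyNPNS Ω γ₁ γ₂ W c₁ c₂ Φ u) (hu : ∀ x ∈ Ω, u x = 0) :
    ∃ p : Euc d → ℝ, ContDiffOn ℝ 1 p Ω ∧
      ∀ x ∈ Ω, fderiv ℝ p x = -((c₁ x - c₂ x) • fderiv ℝ Φ x) := by
  obtain ⟨p, hp, heq⟩ := hsol.navierStokes
  refine ⟨p, hp, fun x hx => ?_⟩
  have hu0 : u =ᶠ[𝓝 x] fun _ => 0 := mem_of_superset (hΩ.mem_nhds hx) hu
  have hlap : Laplacian.laplacian u x = 0 := by
    rw [(InnerProductSpace.laplacian_congr_nhds hu0).self_of_nhds,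
      InnerProductSpace.laplacian_const]
    rfl
  have h1 := heq x hx
  rw [hu x hx, map_zero, hlap, sub_zero, zero_add] at h1
  have h2 := congrArg (InnerProductSpace.toDual ℝ (Euc d)) h1
  simpa [gradient] using h2

theorem mainTheorem4 {d : ℕ} (hd : d = 2 ∨ d = 3) (Ω : Set (Euc d))
    (hΩ : IsSmoothBoundedDomain Ω)
    (γ₁ γ₂ W : Euc d → ℝ)
    (hγ₁ : ContDiffOn ℝ ∞ γ₁ (frontier Ω)) (hγ₂ : ContDiffOn ℝ ∞ γ₂ (frontier Ω))
    (hW : ContDiffOn ℝ ∞ W (frontier Ω))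
    (hγ₁pos : ∀ x ∈ frontier Ω, 0 < γ₁ x) (hγ₂pos : ∀ x ∈ frontier Ω, 0 < γ₂ x)
    (c₁ c₂ Φ : Euc d → ℝ) (u : Euc d → Euc d)
    (hsol : IsSteadyNPNS Ω γ₁ γ₂ W c₁ c₂ Φ u)
    (hbc : ∃ i j : Fin d, i ≠ j ∧
      ((∫ x, (γ₁ x - γ₂ x) * tangentialDeriv Ω i j W x ∂(surfaceMeasure Ω) ≠ 0) ∨
       (∫ x, W x * tangentialDeriv Ω i j (fun y => γ₁ y - γ₂ y) x ∂(surfaceMeasure Ω) ≠ 0))) :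
    ∃ x ∈ Ω, u x ≠ 0 := by
  by_contra! hu
  obtain ⟨p, hp, hpΦ⟩ := hsol.exists_pressure_of_velocity_eq_zero hΩ.isOpen hu
  have hdm : d = (d - 1) + 1 := by omega
  have hΦ : ContDiffOn ℝ 1 Φ (closure Ω) := hsol.reg_Φ.2
  have hρ : ContDiffOn ℝ 1 (fun x => c₁ x - c₂ x) (closure Ω) := hsol.reg_c₁.2.sub hsol.reg_c₂.2
  have hρb : ∀ x ∈ frontier Ω, c₁ x - c₂ x = γ₁ x - γ₂ x := fun x hx => by
    rw [hsol.boundary_c₁ x hx, hsol.boundary_c₂ x hx]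
  have hdΦ := hΦ.continuousOn_fderivWithin hΩ.uniqueDiffOn_closure le_rfl
  have hdρ := hρ.continuousOn_fderivWithin hΩ.uniqueDiffOn_closure le_rfl
  obtain ⟨i, j, -, h | h⟩ := hbc
  · refine h ?_
    -- The covector field `ρ dΦ` equals `d(-p)` in `Ω`.
    rw [← hΩ.integral_tangential_eq_zero hdm (hρ.continuousOn.smul hdΦ) (q := fun x => -p x) hp.neg
      (fun x hx => ?_) i j]
    · refine setIntegral_congr_fun isClosed_frontier.measurableSet fun x hx => ?_
      simp only [hΩ.tangentialDeriv_eq hdm hW hΦ hsol.boundary_Φ i j hx, ← hρb x hx]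
      rfl
    · rw [Pi.smul_apply', fderivWithin_closure_of_mem hΩ.isOpen hx, fderiv_fun_neg, hpΦ x hx, neg_neg]
  · refine h ?_
    -- The potential comes from `Φ dρ = d(ρΦ) - ρ dΦ = d(ρΦ) + dp`.
    rw [← hΩ.integral_tangential_eq_zero hdm (hΦ.continuousOn.smul hdρ)
      (q := fun x => (c₁ x - c₂ x) * Φ x + p x)
      (((hρ.mono subset_closure).mul (hΦ.mono subset_closure)).add hp) (fun x hx => ?_) i j]
    · refine setIntegral_congr_fun isClosed_frontier.measurableSet fun x hx => ?_
      simp only [hΩ.tangentialDeriv_eq hdm (hγ₁.sub hγ₂) hρ hρb i j hx, ← hsol.boundary_Φ x hx]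
      rfl
    · rw [Pi.smul_apply', fderivWithin_closure_of_mem hΩ.isOpen hx]
      have hdiff : ∀ {f : Euc d → ℝ}, ContDiffOn ℝ 1 f Ω → HasFDerivAt f (fderiv ℝ f x) x :=
        fun hf => ((hf.contDiffAt (hΩ.isOpen.mem_nhds hx)).differentiableAt
          one_ne_zero).hasFDerivAt
      have hsum : HasFDerivAt (fun x => (c₁ x - c₂ x) * Φ x + p x) _ x :=
        ((hdiff (hρ.mono subset_closure)).mul (hdiff (hΦ.mono subset_closure))).add (hdiff hp)
      rw [hsum.fderiv, hpΦ x hx]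
      abel
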